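/- **Setting.** Let $I=[0,1]$. The Haar quarks are $\varphi_p(x)=x^p\chi_{[0,1)}(x)$, $p\in\mathbb N_0$, and the Haar quarklets are $\psi_p=\varphi_p(2\cdot)-\varphi_p(2\cdot-1)$; put $\psi_{p,j,k}=2^{j/2}\psi_p(2^j\cdot-k)$ for $j\ge 0$, $0\le k<2^j$, and $\psi_{p,-1,0}=\varphi_p$. Let $\Lambda_I$ be the set of all these indices $(p,j,k)$. Let $w_p\ge 0$ be weights with $w_0=1$ and $\sum_p w_p(p+1)^{-1/2}<\infty$. *Trees.* A node is a pair $\lambda=(j,k)$, $j\ge0$, $0\le k<2^j$, with dyadic interval $I_\lambda=2^{-j}[k,k+1)$, level $|\lambda|=j$ and children $(j+1,2k),(j+1,2k+1)$; $\mu\prec\lambda$ means $I_\lambda\subsetneq I_\mu$. The quark index $(-1,0)$ is assigned to the root $\mathcal R=(0,0)$: in all sums and index sets below, the indices $(p,-1,0)$ are treated as belonging to the node $\mathcal R$. A tree is a finite set $\mathcal T\ni\mathcal R$ of nodes which contains all ancestors of its elements and in which every node has zero or two children; $\mathcal V(\mathcal T)$ is the set of its leaves, and $r(\lambda,\mathcal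 T)$ is the number of leaves $\eta\succeq\lambda$ of $\mathcal T$ minus one. For every node $\lambda$ fix $\mu_\lambda\preceq\lambda$ and put $\Upsilon(\lambda)=\{\mu:\mu_\lambda\preceq\mu\preceq\lambda\}$, where it is required that for every tree $\mathcal T$ the sets $\Upsilon(\lambda)$, $\lambda\in\mathcal V(\mathcal T)$, form a disjoint decomposition of $\mathcal T$. A quarklet tree $T=(\mathcal T,P_{\max})$ consists of a tree $\mathcal T$ and degrees $p_{\max}(\lambda)\in\mathbb N_0$ for $\lambda\in\mathcal V(\mathcal T)$, extended by $p_{\max}(\mu)=p_{\max}(\lambda)$ for $\mu\in\Upsilon(\lambda)$; it is identified with the set of indices $(p,j,k)$ whose node lies in $\mathcal T$ and which satisfy $p\le p_{\max}$ at that node. Put $\#T=|\mathcal T|+\sum_{\mu\in\mathcal T}p_{\max}(\mu)$. *Errors.* Let $f\in L_2(I)$ be given as $f=\sum_{(p,j,k)\in\Lambda_I}c_{p,j,k}w_p\psi_{p,j,k}$ with real $\mathbf c\in\ell_2(\Lambda_I)$. Put $$e_p(\lambda)=\sum_{(i,\ell)\in\Upsilon(\lambda)}\sum_{q>p}|c_{q,i,\ell}|^2+\sum_{(i,\ell)\succ\lambda}\sum_{q\ge0}|c_{q,i,\ell}|^2,\qquad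 \mathcal E(T)=\sum_{\lambda\in\mathcal V(\mathcal T)}e_{p_{\max}(\lambda)}(\lambda),\qquad \sigma_n=\inf_{\#T\le n}\mathcal E(T).$$ *Algorithm.* With $0\cdot0/(0+0):=0$, put $\tilde e(\mathcal R)=e_0(\mathcal R)$ and $\tilde e(\lambda)=\frac{e_0(\lambda)\tilde e(\mu)}{e_0(\lambda)+\tilde e(\mu)}$ if $\mu$ is the parent of $\lambda$. For a tree $\mathcal T$ put $E(\lambda)=e_0(\lambda)$ on leaves and $E(\lambda)=\min\{E(\eta_1)+E(\eta_2),e_{r(\lambda,\mathcal T)}(\lambda)\}$ on inner nodes with children $\eta_1,\eta_2$. Starting with $\mathcal T_0'=\{\mathcal R\}$, the tree $\mathcal T'_{N}$ arises from $\mathcal T'_{N-1}$ by adding the two children of a leaf reached from $\mathcal R$ by moving always to a child with maximal $q$ (ties broken arbitrarily), where $q(\lambda)=\tilde e(\lambda)$ on leaves and $q(\lambda)=\min\{\max\{q(\eta_1),q(\eta_2)\},\tilde E(\lambda)\}$ on inner nodes; here $\tilde E(\lambda)$ starts as $\tilde e(\lambda)$ and, whenever $r(\lambda,\cdot)$ increases,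 is replaced by $\frac{E(\lambda)\tilde E(\lambda)}{E(\lambda)+\tilde E(\lambda)}$ with $E(\lambda)$ taken for the new tree. Trimming: $\mathcal T_N$ arises from $\mathcal T_N'$ by removing all descendants of those nodes $\lambda$ with $E(\lambda)=e_{r(\lambda,\mathcal T_N')}(\lambda)$. Let $T_N=(\mathcal T_N,P_{\max})$ with $p_{\max}(\lambda)=r(\lambda,\mathcal T'_N)$ for $\lambda\in\mathcal V(\mathcal T_N)$, and let $$f_{T_N}=\sum_{(p,j,k)\in T_N}c_{p,j,k}w_p\psi_{p,j,k}.$$ **Lemma.** There is a constant $C>0$, depending only on the weights $(w_p)$, such that for all admissible $\Upsilon$, all $f$ and $\mathbf c$ as above, all $N\ge1$ and all $1\le n\le N$, $$\|f-f_{T_N}\|_{L_2(I)}^2\le C\,\frac{2N+1}{N-n+1}\,\sigma_n .$$ Moreover, the number of indices in $T_N$ is at most $K\,N$, with a constant $K$ depending only on the maximal level $\max_{\lambda\in\mathcal T_N}|\lambda|$. -/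

import Mathlib

open MeasureTheory

noncomputable section

namespace HaarQuarklet

/-! ### Dyadic nodes and wavelet trees on the unit interval -/

/-- A wavelet index `(j, k)` with `j ≥ 0` and `0 ≤ k < 2 ^ j`. -/
@[ext]
structure Node where
  level : ℕ
  pos : ℕ
  pos_lt : pos < 2 ^ level

instance : DecidableEq Node := Classical.decEq _

namespace Node

/-- The root `(0, 0)`. -/
def root : Node := ⟨0, 0, by norm_num⟩

/-- The child `(j + 1, 2 k)`. -/
def left (l : Node) : Node :=
  ⟨l.level + 1, 2 * l.pos, by have := l.pos_lt; rw [pow_succ]; omega⟩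

/-- The child `(j + 1, 2 k + 1)`. -/
def right (l : Node) : Node :=
  ⟨l.level + 1, 2 * l.pos + 1, by have := l.pos_lt; rw [pow_succ]; omega⟩

/-- The parent `(j - 1, ⌊k / 2⌋)` of a node with `j ≥ 1` (the root is sent to itself). -/
def parent (l : Node) : Node :=
  ⟨l.level - 1, l.pos / 2, by
    have h := l.pos_lt
    rcases Nat.eq_zero_or_pos l.level with h0 | h0
    · rw [h0] at h ⊢
      norm_num at h ⊢
      omega
    · obtain ⟨m, hm⟩ := Nat.exists_eq_succ_of_ne_zero h0.ne'
      rw [hm, Nat.succ_eq_add_one, pow_succ] at h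
      rw [hm, Nat.succ_eq_add_one, Nat.add_sub_cancel]
      omega⟩

/-- The dyadic interval `2^{-j} [k, k + 1)`. -/
def interval (l : Node) : Set ℝ :=
  Set.Ico ((l.pos : ℝ) / 2 ^ l.level) (((l.pos : ℝ) + 1) / 2 ^ l.level)

/-- `m ≺ l`: `m` is a (proper) ancestor of `l`, i.e. `l` is a descendant of `m`. -/
def IsAnc (m l : Node) : Prop := l.interval ⊂ m.interval

/-- `m ⪯ l`: `m` is an ancestor of `l` or equal to `l`. -/
def IsAncEq (m l : Node) : Prop := m.IsAnc l ∨ m = l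

end Node

open Node

/-- Finite complete wavelet trees with root `(0, 0)`. -/
structure IsTree (T : Finset Node) : Prop where
  root_mem : root ∈ T
  anc_mem : ∀ l ∈ T, ∀ m : Node, m.IsAnc l → m ∈ T
  complete : ∀ l ∈ T, (l.left ∈ T ↔ l.right ∈ T)

open Classical in
/-- The leaves `𝒱(T)`: the elements of `T` without descendants in `T`. -/
def leaves (T : Finset Node) : Finset Node := T.filter fun l => ∀ m ∈ T, ¬ l.IsAnc m

open Classical in
/-- `r(l, T) = |𝒱(𝒥_l ∩ T)| - 1`, where `𝒥_l` is the infinite tree of all `m ⪰ l`. -/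
def refCount (T : Finset Node) (l : Node) : ℕ :=
  (leaves (T.filter fun m => l.IsAncEq m)).card - 1

/-! ### Enrichment sets and quarklet trees -/

/-- `Υ(l) = {m : l ⪰ m ⪰ μ_l}`, where `top l = μ_l`. -/
def Ups (top : Node → Node) (l : Node) : Set Node :=
  {m | m.IsAncEq l ∧ (top l).IsAncEq m}

/-- The requirements on the sets `Υ(l)`: `μ_l ⪯ l`, and for every tree `T` the sets `Υ(l)`, with
`l` running over the leaves of `T`, form a disjoint decomposition of `T`. In particular `Υ(η₁)` and
`Υ(η₂)` are disjoint for siblings `η₁`, `η₂`. -/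
structure IsEnrichment (top : Node → Node) : Prop where
  top_ancEq : ∀ l, (top l).IsAncEq l
  disjoint : ∀ T, IsTree T → ∀ l ∈ leaves T, ∀ m ∈ leaves T, l ≠ m →
    Disjoint (Ups top l) (Ups top m)
  cover : ∀ T, IsTree T → ⋃ l ∈ leaves T, Ups top l = (T : Set Node)

open Classical in
/-- A quarklet tree is given by a wavelet tree `T` and the maximal degrees `P l` on the leaves `l`
of `T`. This is the induced maximal degree on all nodes of `T`: it equals `P l` on `Υ(l)` for every
leaf `l` (exactly one leaf contributes to the supremum). -/
def pmax (top : Node → Node) (T : Finset Node) (P : Node → ℕ) (m : Node) : ℕ :=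
  ((leaves T).filter fun l => m ∈ Ups top l).sup P

/-- `#(T, P) = |T| + ∑_{m ∈ T} pmax(m)`: the number of quarklet indices `(p, j, k)`, `j ≥ 0`, in
the quarklet tree. -/
def qcard (top : Node → Node) (T : Finset Node) (P : Node → ℕ) : ℕ :=
  T.card + ∑ m ∈ T, pmax top T P m

/-- Quarklet indices on the unit interval. `(p, some (j, k))` is the index `(p, j, k)` with
`j ≥ 0`, and `(p, none)` is the quark index `(p, -1, 0)`. -/
abbrev QIdx : Type := ℕ × Option Node

/-- The tree node to which a wavelet index is assigned; the quark index `(-1, 0)` is assigned to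
the root. -/
def base (a : Option Node) : Node := a.getD root

/-- All quarklet indices in the quarklet tree `(T, P)`, including the quark indices `(p, -1, 0)`
with `p ≤ pmax(root)`. -/
def indices (top : Node → Node) (T : Finset Node) (P : Node → ℕ) : Finset QIdx :=
  (Finset.insertNone T).biUnion fun a =>
    (Finset.range (pmax top T P (base a) + 1)).image fun p => (p, a)

/-! ### Global error and best approximation error, for given local errors `e p l` -/

/-- The global error `ℰ(T, P)`. -/
def globalErr (e : ℕ → Node → ℝ) (T : Finset Node) (P : Node → ℕ) : ℝ :=
  ∑ l ∈ leaves T, e (P l) l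

/-- The error `σ_n` of the best quarklet tree approximation of cardinality `n`. -/
def bestErr (top : Node → Node) (e : ℕ → Node → ℝ) (n : ℕ) : ℝ :=
  sInf {x | ∃ (T : Finset Node) (P : Node → ℕ),
    IsTree T ∧ qcard top T P ≤ n ∧ x = globalErr e T P}

/-! ### The algorithm NEARBEST_TREE and trimming -/

/-- `a b / (a + b)`, which is `0` for `a = b = 0`. -/
def harm (a b : ℝ) : ℝ := a * b / (a + b)

/-- The modified local error `ẽ`. -/
def modErr (e : ℕ → Node → ℝ) (l : Node) : ℝ :=
  if h : l.level = 0 then e 0 l else harm (e 0 l) (modErr e l.parent)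
termination_by l.level
decreasing_by
  simp only [Node.parent]
  omega

/-- The error functional `E(l, T)`. -/
def treeErr (e : ℕ → Node → ℝ) (T : Finset Node) (l : Node) : ℝ :=
  if h : l.left ∈ T ∧ l.right ∈ T then
    min (treeErr e T l.left + treeErr e T l.right) (e (refCount T l) l)
  else e 0 l
termination_by T.sup Node.level + 1 - l.level
decreasing_by
  · have := Finset.le_sup (f := Node.level) h.1
    simp only [Node.left] at this ⊢
    omega
  · have := Finset.le_sup (f := Node.level) h.2
    simp only [Node.right] at this ⊢
    omega

/-- For a growing sequence of trees `S 0, S 1, …`, the functional `Ẽ_{r(l)}(l)` at stage `k`, i.e.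
with `r(l) = r(l, S k)`: it starts with `ẽ(l)` and is updated to
`Ẽ_r(l) = E_r(l) Ẽ_{r-1}(l) / (E_r(l) + Ẽ_{r-1}(l))` whenever `r(l)` increases. -/
def penErr (e : ℕ → Node → ℝ) (S : ℕ → Finset Node) : ℕ → Node → ℝ
  | 0, l => modErr e l
  | k + 1, l =>
    if refCount (S (k + 1)) l = refCount (S k) l then penErr e S k l
    else harm (treeErr e (S (k + 1)) l) (penErr e S k l)

/-- The function `q` at stage `k`, i.e. with respect to the tree `S k`. -/
def thr (e : ℕ → Node → ℝ) (S : ℕ → Finset Node) (k : ℕ) (l : Node) : ℝ :=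
  if h : l.left ∈ S k ∧ l.right ∈ S k then
    min (max (thr e S k l.left) (thr e S k l.right)) (penErr e S k l)
  else modErr e l
termination_by (S k).sup Node.level + 1 - l.level
decreasing_by
  · have := Finset.le_sup (f := Node.level) h.1
    simp only [Node.left] at this ⊢
    omega
  · have := Finset.le_sup (f := Node.level) h.2
    simp only [Node.right] at this ⊢
    omega

/-- `PointsTo q T l m`: `m` is an admissible value of `s(l)`, i.e. `m` is a leaf reached from `l` by
moving in every step to a child with maximal `q`. Ties may be broken in any way. -/
inductive PointsTo (q : Node → ℝ) (T : Finset Node) : Node → Node → Prop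
  | leaf (l : Node) : l ∈ leaves T → PointsTo q T l l
  | left (l m : Node) : l.left ∈ T → q l.right ≤ q l.left → PointsTo q T l.left m → PointsTo q T l m
  | right (l m : Node) : l.right ∈ T → q l.left ≤ q l.right → PointsTo q T l.right m →
      PointsTo q T l m

/-- `S 0, …, S N` are the trees `𝒯'_0, …, 𝒯'_N` of a run of NEARBEST_TREE with `N` steps. -/
def IsRun (e : ℕ → Node → ℝ) (S : ℕ → Finset Node) (N : ℕ) : Prop :=
  S 0 = {root} ∧ ∀ k < N, ∃ l, PointsTo (thr e S k) (S k) root l ∧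
    S (k + 1) = S k ∪ {l.left, l.right}

open Classical in
/-- Trimming: all descendants of nodes `m` with `E(m) = e_{r(m)}(m)` are removed. -/
def trim (e : ℕ → Node → ℝ) (T : Finset Node) : Finset Node :=
  T.filter fun l => ∀ m ∈ T, m.IsAnc l → treeErr e T m ≠ e (refCount T m) m

/-! ### Haar quarks and quarklets -/

/-- The Haar quark `φ_p(x) = x ^ p` on `[0, 1)`, and `0` elsewhere. -/
def quark (p : ℕ) : ℝ → ℝ := Set.indicator (Set.Ico 0 1) fun x => x ^ p

/-- The Haar quarklet `ψ_p = φ_p(2 ·) - φ_p(2 · - 1)`. -/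
def quarklet (p : ℕ) (x : ℝ) : ℝ := quark p (2 * x) - quark p (2 * x - 1)

/-- `ψ_{p,j,k} = 2^{j/2} ψ_p(2^j · - k)` for `j ≥ 0`, and `ψ_{p,-1,0} = φ_p`. -/
def quarkletFun : QIdx → ℝ → ℝ
  | (p, none), x => quark p x
  | (p, some l), x => (2 : ℝ) ^ ((l.level : ℝ) / 2) * quarklet p (2 ^ l.level * x - l.pos)

/-- Lebesgue measure on `I = [0, 1]`. -/
abbrev muI : Measure ℝ := volume.restrict (Set.Icc 0 1)

theorem measurable_quark (p : ℕ) : Measurable (quark p) :=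
  (measurable_id.pow_const p).indicator measurableSet_Ico

theorem abs_quark_le (p : ℕ) (x : ℝ) : |quark p x| ≤ 1 := by
  unfold quark
  by_cases h : x ∈ Set.Ico (0 : ℝ) 1
  · rw [Set.indicator_of_mem h, abs_of_nonneg (pow_nonneg h.1 p)]
    exact pow_le_one₀ h.1 h.2.le
  · rw [Set.indicator_of_notMem h]
    simp

theorem memLp_quarkletFun (x : QIdx) : MemLp (quarkletFun x) 2 muI := by
  obtain ⟨p, _ | l⟩ := x
  · refine MemLp.of_bound (measurable_quark p).aestronglyMeasurable 1 (ae_of_all _ fun t => ?_)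
    exact abs_quark_le p t
  · have hm : Measurable (quarkletFun (p, some l)) := by
      have := measurable_quark p
      unfold quarkletFun quarklet
      fun_prop
    refine MemLp.of_bound hm.aestronglyMeasurable ((2 : ℝ) ^ ((l.level : ℝ) / 2) * 2)
      (ae_of_all _ fun t => ?_)
    simp only [quarkletFun, quarklet, norm_mul, Real.norm_eq_abs]
    rw [abs_of_nonneg (Real.rpow_nonneg (by norm_num : (0 : ℝ) ≤ 2) _)]
    refine mul_le_mul_of_nonneg_left ?_ (by positivity)
    refine (abs_sub _ _).trans ?_
    linarith [abs_quark_le p (2 * (2 ^ l.level * t - l.pos)),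
      abs_quark_le p (2 * (2 ^ l.level * t - l.pos) - 1)]

/-- The quarklet `ψ_{p,j,k}` as an element of `L_2(I)`. -/
def quarkletL2 (x : QIdx) : Lp ℝ 2 muI := (memLp_quarkletFun x).toLp (quarkletFun x)

/-- The local errors `e_p(l)` of a coefficient sequence `c`. -/
def localErr (top : Node → Node) (c : QIdx → ℝ) (p : ℕ) (l : Node) : ℝ :=
  (∑' x : {x : QIdx // base x.2 ∈ Ups top l ∧ p < x.1}, |c x| ^ 2) +
    ∑' x : {x : QIdx // l.IsAnc (base x.2)}, |c x| ^ 2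

/-- The finite part `∑_{x ∈ A} c_x w_p ψ_x` of a quarklet expansion. -/
def partialSum (w : ℕ → ℝ) (c : QIdx → ℝ) (A : Finset QIdx) : Lp ℝ 2 muI :=
  ∑ x ∈ A, (c x * w x.1) • quarkletL2 x

end HaarQuarklet

end

/-!
Let `t` be the final threshold `q(ℛ)` of the algorithm. The penalised error at a node `l` was at
least `t` whenever `r(l)` increased, so the harmonic recursion for it gives
`e_p(l) ≥ (r(l) - p) t` for `p ≤ r(l)`, and summing over the leaves of an arbitrary competitor with
at most `n` degrees of freedom gives `σ_n ≥ (N - n + 1) t`. Read in the other direction, the same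
recursions give `E(ℛ) ≤ (2N + 1) t`, and trimming realizes the error `E(ℛ)`.

Passing from coefficients to `L_2` norms is a Schur test for each degree `p`: by the vanishing mean
and the bounded variation of `ψ_p`, the Gram matrix between the levels `i` and `j` has row sums of
order `2 ^ (-|i - j| / 2) / (p + 1)`. The degrees are then summed by the Cauchy–Schwarz inequality.
-/

namespace HaarQuarklet

open Node

/-! ### The order of the dyadic nodes -/

namespace Node

theorem mem_interval_iff {l : Node} {t : ℝ} :
    t ∈ l.interval ↔ ⌊2 ^ l.level * t⌋ = (l.pos : ℤ) := by
  have hpos : (0 : ℝ) < 2 ^ l.level := by positivity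
  rw [Int.floor_eq_iff, interval, Set.mem_Ico, div_le_iff₀' hpos, lt_div_iff₀' hpos]
  exact_mod_cast Iff.rfl

theorem left_endpoint_mem_interval (l : Node) : (l.pos : ℝ) / 2 ^ l.level ∈ l.interval := by
  rw [mem_interval_iff, mul_div_cancel₀ _ (by positivity), Int.floor_natCast]

theorem mem_interval_iff_div_eq {l m : Node} {i : ℕ} (hi : l.level = m.level + i) {t : ℝ}
    (ht : t ∈ l.interval) : t ∈ m.interval ↔ l.pos / 2 ^ i = m.pos := by
  have hfloor : ⌊2 ^ m.level * t⌋ = ((l.pos / 2 ^ i : ℕ) : ℤ) := by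
    have : (2 : ℝ) ^ m.level * t = 2 ^ l.level * t / (2 ^ i : ℕ) := by
      rw [hi, pow_add, Nat.cast_pow, Nat.cast_ofNat]
      field_simp
    rw [this, Int.floor_div_natCast, mem_interval_iff.1 ht, Int.natCast_div]
  rw [mem_interval_iff, hfloor, Nat.cast_inj]

theorem level_le_of_interval_subset {l m : Node} (h : l.interval ⊆ m.interval) :
    m.level ≤ l.level := by
  rw [interval, interval, Set.Ico_subset_Ico_iff (by gcongr; linarith), add_div, add_div] at h
  have hlength : (1 : ℝ) / 2 ^ l.level ≤ 1 / 2 ^ m.level := by linarith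
  rw [one_div_le_one_div (by positivity) (by positivity)] at hlength
  exact (pow_le_pow_iff_right₀ one_lt_two).1 hlength

theorem interval_subset_iff {l m : Node} :
    l.interval ⊆ m.interval ↔ ∃ i, l.level = m.level + i ∧ l.pos / 2 ^ i = m.pos := by
  constructor
  · intro h
    obtain ⟨i, hi⟩ := Nat.exists_eq_add_of_le (level_le_of_interval_subset h)
    have ht := l.left_endpoint_mem_interval
    exact ⟨i, hi, (mem_interval_iff_div_eq hi ht).1 (h ht)⟩
  · rintro ⟨i, hi, h⟩ t ht
    exact (mem_interval_iff_div_eq hi ht).2 h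

theorem isAncEq_iff_exists {m l : Node} :
    m.IsAncEq l ↔ ∃ i, l.level = m.level + i ∧ l.pos / 2 ^ i = m.pos := by
  rw [← interval_subset_iff]
  constructor
  · rintro (h | rfl)
    · exact h.subset
    · exact subset_rfl
  · intro h
    by_cases hml : m.interval ⊆ l.interval
    · obtain ⟨i, hi, hpos⟩ := interval_subset_iff.1 h
      obtain rfl : i = 0 := by
        have := level_le_of_interval_subset hml
        omega
      exact .inr (Node.ext (by omega) (by simpa using hpos.symm))
    · exact .inl ⟨h, hml⟩

theorem isAncEq_iff_subset {m l : Node} : m.IsAncEq l ↔ l.interval ⊆ m.interval := by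
  rw [isAncEq_iff_exists, interval_subset_iff]

theorem IsAncEq.refl (l : Node) : l.IsAncEq l := .inr rfl

theorem IsAncEq.trans {a b c : Node} (h : a.IsAncEq b) (h' : b.IsAncEq c) : a.IsAncEq c := by
  rw [isAncEq_iff_subset] at *
  exact h'.trans h

theorem IsAncEq.trans_isAnc {a b c : Node} (h : a.IsAncEq b) (h' : b.IsAnc c) : a.IsAnc c :=
  lt_of_lt_of_le h' (isAncEq_iff_subset.1 h)

theorem IsAnc.trans_isAncEq {a b c : Node} (h : a.IsAnc b) (h' : b.IsAncEq c) : a.IsAnc c :=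
  lt_of_le_of_lt (isAncEq_iff_subset.1 h') h

theorem IsAnc.isAncEq {a b : Node} (h : a.IsAnc b) : a.IsAncEq b := .inl h

theorem not_isAnc_self (l : Node) : ¬ l.IsAnc l := ssubset_irrefl _

theorem IsAncEq.level_le {a b : Node} (h : a.IsAncEq b) : a.level ≤ b.level :=
  level_le_of_interval_subset (isAncEq_iff_subset.1 h)

theorem IsAncEq.eq_of_level_eq {a b m : Node} (ha : a.IsAncEq m) (hb : b.IsAncEq m)
    (h : a.level = b.level) : a = b := by
  obtain ⟨i, hi, ha⟩ := isAncEq_iff_exists.1 ha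
  obtain ⟨j, hj, hb⟩ := isAncEq_iff_exists.1 hb
  obtain rfl : i = j := by omega
  exact Node.ext h (ha.symm.trans hb)

theorem IsAnc.level_lt {a b : Node} (h : a.IsAnc b) : a.level < b.level :=
  h.isAncEq.level_le.lt_of_ne fun hlevel =>
    not_isAnc_self b (h.isAncEq.eq_of_level_eq (.refl b) hlevel ▸ h)

theorem eq_root_of_level_eq_zero {l : Node} (h : l.level = 0) : l = root := by
  have hpos := l.pos_lt
  rw [h, pow_zero, Nat.lt_one_iff] at hpos
  exact Node.ext h hpos

theorem not_isAnc_root (l : Node) : ¬ l.IsAnc root := fun h => Nat.not_lt_zero _ h.level_lt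

theorem isAnc_iff_isAncEq_parent {m l : Node} (hl : l.level ≠ 0) :
    m.IsAnc l ↔ m.IsAncEq l.parent := by
  have hhalf (i : ℕ) : l.pos / 2 / 2 ^ i = l.pos / 2 ^ (i + 1) := by
    rw [pow_succ', Nat.div_div_eq_div_mul]
  rw [isAncEq_iff_exists]
  simp only [parent, hhalf]
  constructor
  · intro h
    obtain ⟨i, hi, hpos⟩ := isAncEq_iff_exists.1 h.isAncEq
    have := h.level_lt
    obtain ⟨j, rfl⟩ : ∃ j, i = j + 1 := ⟨i - 1, by omega⟩
    exact ⟨j, by omega, hpos⟩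
  · rintro ⟨i, hi, hpos⟩
    have hml : m.IsAncEq l := isAncEq_iff_exists.2 ⟨i + 1, by omega, hpos⟩
    exact hml.resolve_right (by rintro rfl; omega)

theorem parent_isAnc {l : Node} (hl : l.level ≠ 0) : l.parent.IsAnc l :=
  (isAnc_iff_isAncEq_parent hl).2 (.refl _)

theorem parent_induction {motive : Node → Prop} (root : motive root)
    (step : ∀ l, l.level ≠ 0 → motive l.parent → motive l) (l : Node) : motive l := by
  induction hn : l.level generalizing l with
  | zero => rwa [eq_root_of_level_eq_zero hn]
  | succ n ih => exact step l (by omega) (ih _ (by simp [parent, hn]))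

theorem root_isAncEq (l : Node) : Node.root.IsAncEq l := by
  induction l using parent_induction with
  | root => exact .refl _
  | step l hl ih => exact ((isAnc_iff_isAncEq_parent hl).2 ih).isAncEq

theorem parent_left (l : Node) : l.left.parent = l := by
  ext <;> simp [left, parent]

theorem parent_right (l : Node) : l.right.parent = l := by
  ext <;> simp only [right, parent] <;> omega

theorem level_left_ne_zero (l : Node) : l.left.level ≠ 0 := l.level.succ_ne_zero

theorem level_right_ne_zero (l : Node) : l.right.level ≠ 0 := l.level.succ_ne_zero

theorem eq_left_or_eq_right_parent {l : Node} (hl : l.level ≠ 0) :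
    l = l.parent.left ∨ l = l.parent.right := by
  rcases Nat.even_or_odd' l.pos with ⟨c, hc | hc⟩
  · left
    ext <;> simp only [left, parent] <;> omega
  · right
    ext <;> simp only [right, parent] <;> omega

theorem left_ne_right (l m : Node) : l.left ≠ m.right := by
  intro h
  have := congrArg Node.pos h
  simp only [left, right] at this
  omega

theorem isAnc_left_iff {m l : Node} : m.IsAnc l.left ↔ m.IsAncEq l := by
  rw [isAnc_iff_isAncEq_parent l.level_left_ne_zero, parent_left]

theorem isAnc_right_iff {m l : Node} : m.IsAnc l.right ↔ m.IsAncEq l := by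
  rw [isAnc_iff_isAncEq_parent l.level_right_ne_zero, parent_right]

theorem isAnc_left (l : Node) : l.IsAnc l.left := isAnc_left_iff.2 (.refl _)

theorem isAnc_right (l : Node) : l.IsAnc l.right := isAnc_right_iff.2 (.refl _)

theorem isAnc_iff_children {l m : Node} :
    l.IsAnc m ↔ l.left.IsAncEq m ∨ l.right.IsAncEq m := by
  refine ⟨?_, fun h => h.elim l.isAnc_left.trans_isAncEq l.isAnc_right.trans_isAncEq⟩
  induction m using parent_induction with
  | root => exact fun h => absurd h (not_isAnc_root l)
  | step m hm ih =>
    intro h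
    rcases (isAnc_iff_isAncEq_parent hm).1 h with h | rfl
    · exact (ih h).imp (fun h => (h.trans_isAnc (parent_isAnc hm)).isAncEq)
        (fun h => (h.trans_isAnc (parent_isAnc hm)).isAncEq)
    · exact (eq_left_or_eq_right_parent hm).imp (fun h => .inr h.symm) (fun h => .inr h.symm)

theorem isAncEq_iff_children {l m : Node} :
    l.IsAncEq m ↔ l = m ∨ l.left.IsAncEq m ∨ l.right.IsAncEq m := by
  rw [IsAncEq, isAnc_iff_children, or_comm]

theorem not_isAncEq_left_and_right (l m : Node) : ¬ (l.left.IsAncEq m ∧ l.right.IsAncEq m) :=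
  fun h => left_ne_right l l (h.1.eq_of_level_eq h.2 rfl)

end Node

/-! ### Trees and their leaves -/

theorem mem_leaves {T : Finset Node} {l : Node} :
    l ∈ leaves T ↔ l ∈ T ∧ ∀ m ∈ T, ¬ l.IsAnc m := by
  simp only [leaves, Finset.mem_filter]

theorem leaves_subset (T : Finset Node) : leaves T ⊆ T := fun _ h => (mem_leaves.1 h).1

open Classical in
/-- The leaves of `T` which are equal to or descend from `l`. -/
noncomputable def leavesBelow (T : Finset Node) (l : Node) : Finset Node :=
  (leaves T).filter l.IsAncEq

theorem mem_leavesBelow {T : Finset Node} {l m : Node} :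
    m ∈ leavesBelow T l ↔ m ∈ leaves T ∧ l.IsAncEq m := by
  simp only [leavesBelow, Finset.mem_filter]

theorem leavesBelow_root (T : Finset Node) : leavesBelow T root = leaves T := by
  ext m
  rw [mem_leavesBelow, and_iff_left (root_isAncEq m)]

theorem leavesBelow_of_mem_leaves {T : Finset Node} {l : Node} (hl : l ∈ leaves T) :
    leavesBelow T l = {l} := by
  ext m
  rw [mem_leavesBelow, Finset.mem_singleton]
  constructor
  · rintro ⟨hm, hlm⟩
    exact (hlm.resolve_left ((mem_leaves.1 hl).2 m (leaves_subset T hm))).symm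
  · rintro rfl
    exact ⟨hl, .refl _⟩

theorem leavesBelow_eq_union {T : Finset Node} {l : Node} (hl : l.left ∈ T) :
    leavesBelow T l = leavesBelow T l.left ∪ leavesBelow T l.right := by
  ext m
  have hne : m ∈ leaves T → l ≠ m := by
    rintro hm rfl
    exact (mem_leaves.1 hm).2 _ hl l.isAnc_left
  simp only [Finset.mem_union, mem_leavesBelow, isAncEq_iff_children (l := l) (m := m)]
  tauto

theorem disjoint_leavesBelow_children (T : Finset Node) (l : Node) :
    Disjoint (leavesBelow T l.left) (leavesBelow T l.right) :=
  Finset.disjoint_left.2 fun m hleft hright =>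
    not_isAncEq_left_and_right l m ⟨(mem_leavesBelow.1 hleft).2, (mem_leavesBelow.1 hright).2⟩

theorem sum_leavesBelow {M : Type*} [AddCommMonoid M] (g : Node → M) {T : Finset Node} {l : Node}
    (hl : l.left ∈ T) : ∑ m ∈ leavesBelow T l, g m =
      ∑ m ∈ leavesBelow T l.left, g m + ∑ m ∈ leavesBelow T l.right, g m := by
  rw [leavesBelow_eq_union hl, Finset.sum_union (disjoint_leavesBelow_children T l)]

theorem refCount_eq_card_leavesBelow (T : Finset Node) (l : Node) :
    refCount T l = (leavesBelow T l).card - 1 := by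
  unfold refCount
  congr 2
  ext m
  simp only [mem_leavesBelow, mem_leaves, Finset.mem_filter]
  constructor
  · rintro ⟨⟨hm, hlm⟩, hleaf⟩
    exact ⟨⟨hm, fun a ha hma => hleaf a ⟨ha, hlm.trans hma.isAncEq⟩ hma⟩, hlm⟩
  · rintro ⟨⟨hm, hleaf⟩, hlm⟩
    exact ⟨⟨hm, hlm⟩, fun a ha hma => hleaf a ha.1 hma⟩

theorem coarsening_induction (T : Finset Node) {motive : Node → Prop}
    (step : ∀ l, (l.left ∈ T → motive l.left) → (l.right ∈ T → motive l.right) → motive l)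
    (l : Node) : motive l := by
  induction hn : T.sup Node.level + 1 - l.level using Nat.strong_induction_on generalizing l with
  | _ n ih =>
    refine step l (fun hl => ih _ ?_ _ rfl) (fun hl => ih _ ?_ _ rfl)
    all_goals
      have := Finset.le_sup (f := Node.level) hl
      simp only [left, right] at this ⊢
      omega

namespace IsTree

variable {T : Finset Node}

theorem mem_of_isAncEq (hT : IsTree T) {l m : Node} (hm : m.IsAncEq l) (hl : l ∈ T) : m ∈ T := by
  rcases hm with h | rfl
  · exact hT.anc_mem _ hl _ h
  · exact hl

theorem left_mem_iff_right_mem (hT : IsTree T) (l : Node) : l.left ∈ T ↔ l.right ∈ T :=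
  ⟨fun h => (hT.complete l (hT.anc_mem _ h _ l.isAnc_left)).1 h,
    fun h => (hT.complete l (hT.anc_mem _ h _ l.isAnc_right)).2 h⟩

theorem mem_leaves_iff (hT : IsTree T) {l : Node} : l ∈ leaves T ↔ l ∈ T ∧ l.left ∉ T := by
  rw [mem_leaves]
  refine and_congr_right fun _ => ⟨fun h h' => h _ h' l.isAnc_left, fun h m hm hlm => ?_⟩
  rcases isAnc_iff_children.1 hlm with h' | h'
  · exact h (hT.mem_of_isAncEq h' hm)
  · exact h ((hT.left_mem_iff_right_mem l).2 (hT.mem_of_isAncEq h' hm))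

theorem leavesBelow_nonempty (hT : IsTree T) {l : Node} (hl : l ∈ T) :
    (leavesBelow T l).Nonempty := by
  induction l using coarsening_induction T with
  | step l ihleft _ =>
    by_cases h : l.left ∈ T
    · rw [leavesBelow_eq_union h]
      exact (ihleft h h).mono Finset.subset_union_left
    · rw [leavesBelow_of_mem_leaves (hT.mem_leaves_iff.2 ⟨hl, h⟩)]
      exact Finset.singleton_nonempty _

theorem card_leavesBelow (hT : IsTree T) {l : Node} (hl : l ∈ T) :
    (leavesBelow T l).card = refCount T l + 1 := by
  rw [refCount_eq_card_leavesBelow, Nat.sub_add_cancel (hT.leavesBelow_nonempty hl).card_pos]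

theorem refCount_eq_zero (hT : IsTree T) {l : Node} (hl : l.left ∉ T) : refCount T l = 0 := by
  by_cases h : l ∈ T
  · rw [refCount_eq_card_leavesBelow, leavesBelow_of_mem_leaves (hT.mem_leaves_iff.2 ⟨h, hl⟩),
      Finset.card_singleton]
  · have hempty : leavesBelow T l = ∅ := Finset.eq_empty_of_forall_notMem fun m hm =>
      h (hT.mem_of_isAncEq (mem_leavesBelow.1 hm).2 (leaves_subset T (mem_leavesBelow.1 hm).1))
    rw [refCount_eq_card_leavesBelow, hempty, Finset.card_empty]

theorem refCount_eq_add (hT : IsTree T) {l : Node} (hl : l.left ∈ T) :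
    refCount T l = refCount T l.left + refCount T l.right + 1 := by
  rw [refCount_eq_card_leavesBelow, leavesBelow_eq_union hl,
    Finset.card_union_of_disjoint (disjoint_leavesBelow_children T l), hT.card_leavesBelow hl,
    hT.card_leavesBelow ((hT.left_mem_iff_right_mem l).1 hl)]
  omega

theorem refCount_mono {T' : Finset Node} (hT : IsTree T) (hT' : IsTree T') (hsub : T ⊆ T')
    (l : Node) : refCount T l ≤ refCount T' l := by
  induction l using coarsening_induction T with
  | step l ihleft ihright =>
    by_cases h : l.left ∈ T
    · have := ihleft h
      have := ihright ((hT.left_mem_iff_right_mem l).1 h)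
      rw [hT.refCount_eq_add h, hT'.refCount_eq_add (hsub h)]
      omega
    · rw [hT.refCount_eq_zero h]
      exact Nat.zero_le _

theorem exists_leaf_isAnc (hT : IsTree T) {l : Node} (hl : l ∉ T) : ∃ m ∈ leaves T, m.IsAnc l := by
  induction l using parent_induction with
  | root => exact absurd hT.root_mem hl
  | step l hlevel ih =>
    by_cases h : l.parent ∈ T
    · refine ⟨l.parent, hT.mem_leaves_iff.2 ⟨h, fun hleft => hl ?_⟩, parent_isAnc hlevel⟩
      rcases eq_left_or_eq_right_parent hlevel with h' | h' <;> rw [h']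
      · exact hleft
      · exact (hT.left_mem_iff_right_mem _).1 hleft
    · obtain ⟨m, hm, hanc⟩ := ih h
      exact ⟨m, hm, hanc.trans_isAncEq (parent_isAnc hlevel).isAncEq⟩

theorem singleton_root : IsTree {root} where
  root_mem := Finset.mem_singleton_self _
  anc_mem l hl m hm := by
    rw [Finset.mem_singleton.1 hl] at hm
    exact absurd hm (not_isAnc_root m)
  complete l _ := by
    have hleft : l.left ≠ root := fun h => l.level_left_ne_zero (congrArg Node.level h)
    have hright : l.right ≠ root := fun h => l.level_right_ne_zero (congrArg Node.level h)
    simp only [Finset.mem_singleton, hleft, hright]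

section refine_leaf

variable {m : Node}

theorem left_mem_refine_iff {l : Node} : l.left ∈ T ∪ {m.left, m.right} ↔ l.left ∈ T ∨ l = m := by
  have hinj : l.left = m.left ↔ l = m :=
    ⟨fun h => by rw [← parent_left l, h, parent_left], fun h => by rw [h]⟩
  simp only [Finset.mem_union, Finset.mem_insert, Finset.mem_singleton, hinj, left_ne_right,
    or_false]

theorem right_mem_refine_iff {l : Node} :
    l.right ∈ T ∪ {m.left, m.right} ↔ l.right ∈ T ∨ l = m := by
  have hinj : l.right = m.right ↔ l = m :=
    ⟨fun h => by rw [← parent_right l, h, parent_right], fun h => by rw [h]⟩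
  simp only [Finset.mem_union, Finset.mem_insert, Finset.mem_singleton, hinj,
    (left_ne_right m l).symm, false_or]

theorem refine_leaf (hT : IsTree T) (hm : m ∈ leaves T) : IsTree (T ∪ {m.left, m.right}) where
  root_mem := Finset.mem_union_left _ hT.root_mem
  anc_mem l hl a ha := by
    refine Finset.mem_union_left _ ?_
    simp only [Finset.mem_union, Finset.mem_insert, Finset.mem_singleton] at hl
    rcases hl with hl | rfl | rfl
    · exact hT.anc_mem _ hl _ ha
    · exact hT.mem_of_isAncEq (isAnc_left_iff.1 ha) (leaves_subset T hm)
    · exact hT.mem_of_isAncEq (isAnc_right_iff.1 ha) (leaves_subset T hm)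
  complete l _ := by
    rw [left_mem_refine_iff, right_mem_refine_iff, hT.left_mem_iff_right_mem]

theorem children_notMem_of_mem_leaves (hT : IsTree T) (hm : m ∈ leaves T) :
    m.left ∉ T ∧ m.right ∉ T :=
  have h := (hT.mem_leaves_iff.1 hm).2
  ⟨h, (hT.left_mem_iff_right_mem m).not.1 h⟩

theorem leaves_refine (hT : IsTree T) (hm : m ∈ leaves T) :
    leaves (T ∪ {m.left, m.right}) = insert m.left (insert m.right ((leaves T).erase m)) := by
  have hchildren := hT.children_notMem_of_mem_leaves hm
  have hgrandchildren (a : Node) (ha : m.IsAncEq a) : a.left ∉ T := fun h =>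
    (mem_leaves.1 hm).2 _ h (isAnc_left_iff.2 ha)
  ext l
  rw [(hT.refine_leaf hm).mem_leaves_iff, left_mem_refine_iff]
  simp only [Finset.mem_union, Finset.mem_insert, Finset.mem_singleton, Finset.mem_erase,
    hT.mem_leaves_iff]
  constructor
  · tauto
  · have hleft : m.left ≠ m := (ne_of_mem_of_not_mem (leaves_subset T hm) hchildren.1).symm
    have hright : m.right ≠ m := (ne_of_mem_of_not_mem (leaves_subset T hm) hchildren.2).symm
    have := hgrandchildren _ m.isAnc_left.isAncEq
    have := hgrandchildren _ m.isAnc_right.isAncEq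
    rintro (rfl | rfl | h) <;> tauto

open Classical in
theorem card_leavesBelow_refine (hT : IsTree T) (hm : m ∈ leaves T) {l : Node} (hl : l ∈ T) :
    (leavesBelow (T ∪ {m.left, m.right}) l).card =
      (leavesBelow T l).card + if l.IsAncEq m then 1 else 0 := by
  obtain ⟨hleft, hright⟩ := hT.children_notMem_of_mem_leaves hm
  have hanc_left : l.IsAncEq m.left ↔ l.IsAncEq m := by
    rw [IsAncEq, isAnc_left_iff, or_iff_left (ne_of_mem_of_not_mem hl hleft)]
  have hanc_right : l.IsAncEq m.right ↔ l.IsAncEq m := by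
    rw [IsAncEq, isAnc_right_iff, or_iff_left (ne_of_mem_of_not_mem hl hright)]
  have hnotMem {a : Node} (ha : a ∉ T) : a ∉ (leaves T).erase m := fun h =>
    ha (leaves_subset T (Finset.mem_of_mem_erase h))
  rw [leavesBelow, leavesBelow, hT.leaves_refine hm, Finset.card_filter, Finset.card_filter,
    Finset.sum_insert (by simp [left_ne_right, hleft, mem_leaves]),
    Finset.sum_insert (hnotMem hright), ← Finset.add_sum_erase _ _ hm, hanc_left, hanc_right]
  omega

open Classical in
theorem refCount_refine (hT : IsTree T) (hm : m ∈ leaves T) (l : Node) :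
    refCount (T ∪ {m.left, m.right}) l = refCount T l + if l.IsAncEq m then 1 else 0 := by
  by_cases hl : l ∈ T
  · have h := hT.card_leavesBelow_refine hm hl
    rw [hT.card_leavesBelow hl,
      (hT.refine_leaf hm).card_leavesBelow (Finset.mem_union_left _ hl)] at h
    omega
  · have hm' := leaves_subset T hm
    have hleft : l.left ∉ T := fun h => hl (hT.anc_mem _ h _ l.isAnc_left)
    rw [if_neg fun h => hl (hT.mem_of_isAncEq h hm'), hT.refCount_eq_zero hleft,
      (hT.refine_leaf hm).refCount_eq_zero]
    rw [left_mem_refine_iff, not_or]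
    exact ⟨hleft, (ne_of_mem_of_not_mem hm' hl).symm⟩

end refine_leaf

end IsTree

/-! ### Local errors -/

theorem harm_nonneg {a b : ℝ} (ha : 0 ≤ a) (hb : 0 ≤ b) : 0 ≤ harm a b :=
  div_nonneg (mul_nonneg ha hb) (add_nonneg ha hb)

theorem harm_pos {a b : ℝ} (ha : 0 < a) (hb : 0 < b) : 0 < harm a b :=
  div_pos (mul_pos ha hb) (add_pos ha hb)

theorem inv_harm {a b : ℝ} (ha : 0 < a) (hb : 0 < b) : (harm a b)⁻¹ = a⁻¹ + b⁻¹ := by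
  rw [harm, inv_div, inv_add_inv ha.ne' hb.ne']

theorem mul_harm_le {a b s x : ℝ} (ha : 0 ≤ a) (hb : 0 ≤ b) (hax : a ≤ x) (hbx : s * b ≤ x) :
    (s + 1) * harm a b ≤ x := by
  rcases (add_nonneg ha hb).eq_or_lt with h | h
  · rw [harm, ← h, div_zero, mul_zero]
    exact ha.trans hax
  · rw [harm, ← mul_div_assoc, div_le_iff₀ h]
    linarith [mul_le_mul_of_nonneg_right hbx ha, mul_le_mul_of_nonneg_right hax hb]

theorem le_harm_mul {a b s x : ℝ} (ha : 0 ≤ a) (hb : 0 ≤ b) (hxa : x ≤ a) (hxb : x ≤ b * s) :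
    x ≤ harm a b * (s + 1) := by
  rcases (add_nonneg ha hb).eq_or_lt with h | h
  · rw [harm, ← h, div_zero, zero_mul]
    linarith
  · rw [harm, div_mul_eq_mul_div, le_div_iff₀ h]
    linarith [mul_le_mul_of_nonneg_right hxb ha, mul_le_mul_of_nonneg_right hxa hb]

theorem harm_le_left {a b : ℝ} (ha : 0 ≤ a) (hb : 0 ≤ b) : harm a b ≤ a := by
  simpa using mul_harm_le (s := 0) ha hb le_rfl (by simpa using ha)

theorem harm_le_right {a b : ℝ} (ha : 0 ≤ a) (hb : 0 ≤ b) : harm a b ≤ b := by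
  rw [harm, mul_comm, add_comm]
  exact harm_le_left hb ha

/-- Nonnegative local errors which decrease in the degree and are subadditive under refinement for
degree `0`: what the analysis of the algorithm needs to know about `localErr`. -/
structure IsLocalError (e : ℕ → Node → ℝ) : Prop where
  nonneg : ∀ p l, 0 ≤ e p l
  anti : ∀ l, Antitone fun p => e p l
  children_le : ∀ l : Node, e 0 l.left + e 0 l.right ≤ e 0 l

variable {e : ℕ → Node → ℝ} {T : Finset Node}

theorem modErr_root : modErr e root = e 0 root := by
  rw [modErr, dif_pos (show root.level = 0 from rfl)]

theorem modErr_eq_harm {l : Node} (hl : l.level ≠ 0) :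
    modErr e l = harm (e 0 l) (modErr e l.parent) := by
  rw [modErr, dif_neg hl]

theorem treeErr_eq_min (hT : IsTree T) {l : Node} (hl : l.left ∈ T) :
    treeErr e T l = min (treeErr e T l.left + treeErr e T l.right) (e (refCount T l) l) := by
  rw [treeErr, dif_pos ⟨hl, (hT.left_mem_iff_right_mem l).1 hl⟩]

theorem treeErr_of_left_notMem {l : Node} (hl : l.left ∉ T) : treeErr e T l = e 0 l := by
  rw [treeErr, dif_neg fun h => hl h.1]

theorem treeErr_le (hT : IsTree T) (l : Node) : treeErr e T l ≤ e (refCount T l) l := by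
  by_cases h : l.left ∈ T
  · rw [treeErr_eq_min hT h]
    exact min_le_right _ _
  · rw [treeErr_of_left_notMem h, hT.refCount_eq_zero h]

namespace IsLocalError

theorem le_parent (he : IsLocalError e) {l : Node} (hl : l.level ≠ 0) : e 0 l ≤ e 0 l.parent := by
  have hchildren := he.children_le l.parent
  rcases eq_left_or_eq_right_parent hl with h | h
  · rw [← h] at hchildren
    linarith [he.nonneg 0 l.parent.right]
  · rw [← h] at hchildren
    linarith [he.nonneg 0 l.parent.left]

theorem modErr_nonneg (he : IsLocalError e) (l : Node) : 0 ≤ modErr e l := by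
  induction l using parent_induction with
  | root => rw [modErr_root]; exact he.nonneg _ _
  | step l hl ih => rw [modErr_eq_harm hl]; exact harm_nonneg (he.nonneg _ _) ih

theorem modErr_pos (he : IsLocalError e) {l : Node} (hpos : 0 < e 0 l) : 0 < modErr e l := by
  induction l using parent_induction with
  | root => rwa [modErr_root]
  | step l hl ih =>
    rw [modErr_eq_harm hl]
    exact harm_pos hpos (ih (hpos.trans_le (he.le_parent hl)))

theorem modErr_le (he : IsLocalError e) (l : Node) : modErr e l ≤ e 0 l := by
  cases l using parent_induction with
  | root => rw [modErr_root]
  | step l hl => rw [modErr_eq_harm hl]; exact harm_le_left (he.nonneg _ _) (he.modErr_nonneg _)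

theorem div_modErr_le (he : IsLocalError e) {l : Node} (hl : l.level ≠ 0) {x : ℝ} (hx : 0 ≤ x)
    (hxe : x ≤ e 0 l) : x / modErr e l ≤ 1 + x / modErr e l.parent := by
  rcases (he.nonneg 0 l).eq_or_lt with h | hpos
  · rw [le_antisymm (hxe.trans h.ge) hx]
    simp
  · rw [modErr_eq_harm hl, div_eq_mul_inv, div_eq_mul_inv,
      inv_harm hpos (he.modErr_pos (hpos.trans_le (he.le_parent hl))), mul_add,
      ← div_eq_mul_inv x (e 0 l)]
    gcongr
    exact div_le_one_of_le₀ hxe hpos.le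

theorem treeErr_nonneg (he : IsLocalError e) (hT : IsTree T) (l : Node) : 0 ≤ treeErr e T l := by
  induction l using coarsening_induction T with
  | step l ihleft ihright =>
    by_cases h : l.left ∈ T
    · rw [treeErr_eq_min hT h]
      exact le_min (add_nonneg (ihleft h) (ihright ((hT.left_mem_iff_right_mem l).1 h)))
        (he.nonneg _ _)
    · rw [treeErr_of_left_notMem h]
      exact he.nonneg _ _

theorem treeErr_le_zero (he : IsLocalError e) (hT : IsTree T) (l : Node) :
    treeErr e T l ≤ e 0 l :=
  (treeErr_le hT l).trans (he.anti l (Nat.zero_le _))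

theorem treeErr_anti (he : IsLocalError e) {T' : Finset Node} (hT : IsTree T) (hT' : IsTree T')
    (hsub : T ⊆ T') (l : Node) : treeErr e T' l ≤ treeErr e T l := by
  induction l using coarsening_induction T' with
  | step l ihleft ihright =>
    by_cases h : l.left ∈ T
    · have h' := hsub h
      rw [treeErr_eq_min hT h, treeErr_eq_min hT' h']
      exact min_le_min (add_le_add (ihleft h') (ihright ((hT'.left_mem_iff_right_mem l).1 h')))
        (he.anti l (hT.refCount_mono hT' hsub l))
    · rw [treeErr_of_left_notMem h]
      exact he.treeErr_le_zero hT' l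

end IsLocalError

/-! ### Runs of the algorithm -/

namespace PointsTo

variable {q : Node → ℝ} {T : Finset Node} {l m : Node}

theorem mem_leaves (h : PointsTo q T l m) : m ∈ leaves T := by
  induction h with
  | leaf _ hl => exact hl
  | left _ _ _ _ _ ih => exact ih
  | right _ _ _ _ _ ih => exact ih

theorem isAncEq (h : PointsTo q T l m) : l.IsAncEq m := by
  induction h with
  | leaf l => exact .refl l
  | left l m _ _ _ ih => exact (l.isAnc_left.trans_isAncEq ih).isAncEq
  | right l m _ _ _ ih => exact (l.isAnc_right.trans_isAncEq ih).isAncEq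

theorem le_of_isAncEq (h : PointsTo q T l m)
    (hq : ∀ l : Node, l.left ∈ T ∨ l.right ∈ T → q l ≤ max (q l.left) (q l.right))
    {a : Node} (hla : l.IsAncEq a) (ham : a.IsAncEq m) : q l ≤ q a := by
  induction h with
  | leaf l =>
    rw [hla.resolve_left fun h => not_isAnc_self l (h.trans_isAncEq ham)]
  | left l m hl hle hpath ih =>
    rcases isAncEq_iff_children.1 hla with rfl | hleft | hright
    · exact le_rfl
    · exact ((hq l (.inl hl)).trans_eq (max_eq_left hle)).trans (ih hleft ham)
    · exact absurd ⟨hpath.isAncEq, hright.trans ham⟩ (not_isAncEq_left_and_right l m)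
  | right l m hl hle hpath ih =>
    rcases isAncEq_iff_children.1 hla with rfl | hleft | hright
    · exact le_rfl
    · exact absurd ⟨hleft.trans ham, hpath.isAncEq⟩ (not_isAncEq_left_and_right l m)
    · exact ((hq l (.inr hl)).trans_eq (max_eq_right hle)).trans (ih hright ham)

end PointsTo

variable {e : ℕ → Node → ℝ} {S : ℕ → Finset Node} {N k : ℕ}

theorem thr_eq_min (hT : IsTree (S k)) {l : Node} (hl : l.left ∈ S k) :
    thr e S k l = min (max (thr e S k l.left) (thr e S k l.right)) (penErr e S k l) := by
  rw [thr, dif_pos ⟨hl, (hT.left_mem_iff_right_mem l).1 hl⟩]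

theorem thr_of_left_notMem {l : Node} (hl : l.left ∉ S k) : thr e S k l = modErr e l := by
  rw [thr, dif_neg fun h => hl h.1]

theorem PointsTo.thr_root_le {m : Node} (h : PointsTo (thr e S k) (S k) root m)
    (hT : IsTree (S k)) {a : Node} (ha : a.IsAncEq m) : thr e S k root ≤ thr e S k a := by
  refine h.le_of_isAncEq (fun l hl => ?_) (root_isAncEq a) ha
  rw [thr_eq_min hT (by rwa [← hT.left_mem_iff_right_mem, or_self] at hl)]
  exact min_le_left _ _

namespace IsRun

theorem isTree (hS : IsRun e S N) (hk : k ≤ N) : IsTree (S k) := by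
  induction k with
  | zero => exact hS.1 ▸ IsTree.singleton_root
  | succ k ih =>
    obtain ⟨m, hm, hSk⟩ := hS.2 k hk
    rw [hSk]
    exact (ih (Nat.le_of_lt hk)).refine_leaf hm.mem_leaves

theorem subset_succ (hS : IsRun e S N) (hk : k < N) : S k ⊆ S (k + 1) := by
  obtain ⟨m, -, hSk⟩ := hS.2 k hk
  rw [hSk]
  exact Finset.subset_union_left

theorem refCount_succ (hS : IsRun e S N) (hk : k < N) (l : Node) :
    refCount (S (k + 1)) l = refCount (S k) l ∨
      refCount (S (k + 1)) l = refCount (S k) l + 1 ∧ thr e S k root ≤ thr e S k l := by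
  obtain ⟨m, hm, hSk⟩ := hS.2 k hk
  have hT := hS.isTree hk.le
  rw [hSk, hT.refCount_refine hm.mem_leaves]
  split_ifs with hl
  · exact .inr ⟨rfl, hm.thr_root_le hT hl⟩
  · exact .inl rfl

theorem refCount_zero (hS : IsRun e S N) (l : Node) : refCount (S 0) l = 0 := by
  rw [hS.1]
  exact IsTree.singleton_root.refCount_eq_zero fun h =>
    l.level_left_ne_zero (congrArg Node.level (Finset.mem_singleton.1 h))

theorem refCount_root (hS : IsRun e S N) (hk : k ≤ N) : refCount (S k) root = k := by
  induction k with
  | zero => exact hS.refCount_zero root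
  | succ k ih =>
    have hk' : k ≤ N := Nat.le_of_lt hk
    obtain ⟨m, hm, hSk⟩ := hS.2 k hk
    rw [hSk, (hS.isTree hk').refCount_refine hm.mem_leaves, if_pos (root_isAncEq m), ih hk']

theorem penErr_eq_modErr (hS : IsRun e S N) (hk : k ≤ N) {l : Node}
    (hl : refCount (S k) l = 0) : penErr e S k l = modErr e l := by
  induction k with
  | zero => rfl
  | succ k ih =>
    have hl' : refCount (S k) l = 0 := by
      rcases hS.refCount_succ hk l with h | ⟨h, -⟩ <;> omega
    rw [penErr, if_pos (hl.trans hl'.symm), ih (Nat.le_of_lt hk) hl']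

theorem thr_le_penErr (hS : IsRun e S N) (hk : k ≤ N) (l : Node) :
    thr e S k l ≤ penErr e S k l := by
  have hT := hS.isTree hk
  by_cases h : l.left ∈ S k
  · rw [thr_eq_min hT h]
    exact min_le_right _ _
  · rw [thr_of_left_notMem h, hS.penErr_eq_modErr hk (hT.refCount_eq_zero h)]

end IsRun

theorem le_mul_add_div_of_le {x y t r M : ℝ} (hx : 0 ≤ x) (htr : 0 ≤ t * r) (hxy : x ≤ y)
    (hy : y ≤ t * (r + y / M)) : x ≤ t * (r + x / M) := by
  have hcomm (z : ℝ) : t * (r + z / M) = t * r + z * (t / M) := by ring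
  rw [hcomm] at hy ⊢
  rcases le_total (t / M) 1 with h | h
  · linarith [mul_le_mul_of_nonneg_right hxy (sub_nonneg.2 h)]
  · linarith [mul_le_mul_of_nonneg_left h hx]

namespace IsLocalError

theorem penErr_nonneg (he : IsLocalError e) (hS : IsRun e S N) (hk : k ≤ N) (l : Node) :
    0 ≤ penErr e S k l := by
  induction k with
  | zero => exact he.modErr_nonneg l
  | succ k ih =>
    have ih := ih (Nat.le_of_lt hk)
    rw [penErr]
    split_ifs
    · exact ih
    · exact harm_nonneg (he.treeErr_nonneg (hS.isTree hk) l) ih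

theorem penErr_succ_le (he : IsLocalError e) (hS : IsRun e S N) (hk : k < N) (l : Node) :
    penErr e S (k + 1) l ≤ penErr e S k l := by
  rw [penErr]
  split_ifs
  · exact le_rfl
  · exact harm_le_right (he.treeErr_nonneg (hS.isTree hk) l) (he.penErr_nonneg hS hk.le l)

theorem thr_nonneg (he : IsLocalError e) (hS : IsRun e S N) (hk : k ≤ N) (l : Node) :
    0 ≤ thr e S k l := by
  induction l using coarsening_induction (S k) with
  | step l ihleft _ =>
    by_cases h : l.left ∈ S k
    · rw [thr_eq_min (hS.isTree hk) h]
      exact le_min ((ihleft h).trans (le_max_left _ _)) (he.penErr_nonneg hS hk l)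
    · rw [thr_of_left_notMem h]
      exact he.modErr_nonneg l

theorem thr_succ_le (he : IsLocalError e) (hS : IsRun e S N) (hk : k < N) (l : Node) :
    thr e S (k + 1) l ≤ thr e S k l := by
  have hT := hS.isTree hk.le
  have hT' := hS.isTree hk
  have hpen := he.penErr_succ_le hS hk l
  induction l using coarsening_induction (S k) with
  | step l ihleft ihright =>
    by_cases h : l.left ∈ S k
    · rw [thr_eq_min hT h, thr_eq_min hT' (hS.subset_succ hk h)]
      exact min_le_min (max_le_max (ihleft h (he.penErr_succ_le hS hk _))
        (ihright ((hT.left_mem_iff_right_mem l).1 h) (he.penErr_succ_le hS hk _))) hpen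
    · rw [thr_of_left_notMem h, ← hS.penErr_eq_modErr hk.le (hT.refCount_eq_zero h)]
      exact (hS.thr_le_penErr hk l).trans hpen

theorem thr_anti (he : IsLocalError e) (hS : IsRun e S N) (l : Node) {k' : ℕ} (h : k ≤ k')
    (hk' : k' ≤ N) : thr e S k' l ≤ thr e S k l := by
  induction k', h using Nat.le_induction with
  | base => exact le_rfl
  | succ k' _ ih => exact (he.thr_succ_le hS hk' l).trans (ih (Nat.le_of_lt hk'))

theorem mul_penErr_le (he : IsLocalError e) (hS : IsRun e S N) (hk : k ≤ N) {l : Node} {p : ℕ}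
    (hp : p ≤ refCount (S k) l) :
    ((refCount (S k) l : ℝ) - p + 1) * penErr e S k l ≤ e p l := by
  induction k with
  | zero =>
    rw [hS.refCount_zero] at hp ⊢
    obtain rfl : p = 0 := by omega
    simpa [penErr] using he.modErr_le l
  | succ k ih =>
    have hk' : k ≤ N := Nat.le_of_lt hk
    have hT := hS.isTree hk
    rcases hS.refCount_succ hk l with h | ⟨h, -⟩
    · rw [penErr, if_pos h, h]
      exact ih hk' (h ▸ hp)
    · have hE : treeErr e (S (k + 1)) l ≤ e p l := (treeErr_le hT l).trans (he.anti l hp)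
      rw [penErr, if_neg (by omega), h]
      refine mul_harm_le (he.treeErr_nonneg hT l) (he.penErr_nonneg hS hk' l) hE ?_
      rw [h] at hp
      rcases hp.eq_or_lt with rfl | hlt
      · rw [sub_self, zero_mul]
        exact he.nonneg _ _
      · rw [Nat.cast_add_one, add_sub_right_comm]
        exact ih hk' (Nat.lt_succ_iff.1 hlt)

/- Whenever `r(l)` increases, `l` lies on the path of maximal `q`, so that its penalised error was
at least `q(root)`, which never increases. -/
theorem mul_thr_root_le (he : IsLocalError e) (hS : IsRun e S N) (hk : k ≤ N) (l : Node) (p : ℕ) :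
    ((refCount (S k) l : ℝ) - p) * thr e S N root ≤ e p l := by
  have ht := he.thr_nonneg hS le_rfl root
  have hsmall {r : ℕ} (hr : r ≤ p) : ((r : ℝ) - p) * thr e S N root ≤ e p l :=
    (mul_nonpos_of_nonpos_of_nonneg (sub_nonpos.2 (Nat.cast_le.2 hr)) ht).trans (he.nonneg p l)
  induction k with
  | zero => exact hsmall (by rw [hS.refCount_zero]; exact p.zero_le)
  | succ k ih =>
    have hk' : k ≤ N := Nat.le_of_lt hk
    rcases hS.refCount_succ hk l with h | ⟨h, hthr⟩
    · rw [h]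
      exact ih hk'
    · rw [h]
      by_cases hp : p ≤ refCount (S k) l
      · have hpen : thr e S N root ≤ penErr e S k l :=
          ((he.thr_anti hS root hk' le_rfl).trans hthr).trans (hS.thr_le_penErr hk' l)
        have hfactor : 0 ≤ (refCount (S k) l : ℝ) - p + 1 := by
          linarith [(Nat.cast_le (α := ℝ)).2 hp]
        calc ((refCount (S k) l + 1 : ℕ) - p : ℝ) * thr e S N root
            = ((refCount (S k) l : ℝ) - p + 1) * thr e S N root := by push_cast; ring
          _ ≤ ((refCount (S k) l : ℝ) - p + 1) * penErr e S k l := by gcongr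
          _ ≤ e p l := he.mul_penErr_le hS hk' hp
      · exact hsmall (by omega)

theorem le_penErr_mul (he : IsLocalError e) (hS : IsRun e S N) (hk : k ≤ N) {l : Node} {x : ℝ}
    (hx : 0 ≤ x) (hxE : x ≤ treeErr e (S k) l) :
    x ≤ penErr e S k l * (refCount (S k) l + x / modErr e l) := by
  induction k with
  | zero =>
    have hcancel : modErr e l = 0 → x = 0 := fun h => hx.antisymm' <| by
      by_contra! hpos
      exact (he.modErr_pos (hpos.trans_le (hxE.trans (he.treeErr_le_zero (hS.isTree hk) l)))).ne' h
    rw [hS.refCount_zero, Nat.cast_zero, zero_add, penErr, mul_div_cancel_of_imp' hcancel]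
  | succ k ih =>
    have hk' : k ≤ N := Nat.le_of_lt hk
    have hxk := hxE.trans (he.treeErr_anti (hS.isTree hk') (hS.isTree hk) (hS.subset_succ hk) l)
    rcases hS.refCount_succ hk l with h | ⟨h, -⟩
    · rw [penErr, if_pos h, h]
      exact ih hk' hxk
    · rw [penErr, if_neg (by omega), h, Nat.cast_add_one, add_right_comm]
      exact le_harm_mul (he.treeErr_nonneg (hS.isTree hk) l) (he.penErr_nonneg hS hk' l) hxE
        (ih hk' hxk)

theorem treeErr_le_mul_of_penErr_le (he : IsLocalError e) (hS : IsRun e S N) {t : ℝ} {l : Node}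
    (hl : penErr e S N l ≤ t) :
    treeErr e (S N) l ≤ t * (2 * refCount (S N) l + treeErr e (S N) l / modErr e l) := by
  have hE := he.treeErr_nonneg (hS.isTree le_rfl) l
  have hquot := div_nonneg hE (he.modErr_nonneg l)
  calc treeErr e (S N) l
      ≤ penErr e S N l * (refCount (S N) l + treeErr e (S N) l / modErr e l) :=
        he.le_penErr_mul hS le_rfl hE le_rfl
    _ ≤ t * (2 * refCount (S N) l + treeErr e (S N) l / modErr e l) := by
        gcongr
        · exact (he.penErr_nonneg hS le_rfl l).trans hl
        · exact le_mul_of_one_le_left (Nat.cast_nonneg _) one_le_two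

theorem treeErr_le_mul_of_thr_le (he : IsLocalError e) (hS : IsRun e S N) {t : ℝ} (ht : 0 ≤ t)
    {l : Node} (hl : thr e S N l ≤ t) :
    treeErr e (S N) l ≤ t * (2 * refCount (S N) l + treeErr e (S N) l / modErr e l) := by
  have hT := hS.isTree le_rfl
  have hchild {a : Node} (ha : a.level ≠ 0)
      (h : treeErr e (S N) a ≤ t * (2 * refCount (S N) a + treeErr e (S N) a / modErr e a)) :
      treeErr e (S N) a ≤
        t * (2 * refCount (S N) a + (1 + treeErr e (S N) a / modErr e a.parent)) := by
    refine h.trans ?_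
    gcongr
    exact he.div_modErr_le ha (he.treeErr_nonneg hT a) (he.treeErr_le_zero hT a)
  induction l using coarsening_induction (S N) with
  | step l ihleft ihright =>
    by_cases h : l.left ∈ S N
    · rw [thr_eq_min hT h, min_le_iff, max_le_iff] at hl
      rcases hl with ⟨hlleft, hlright⟩ | hpen
      · have hleft := hchild l.level_left_ne_zero (ihleft h hlleft)
        have hright := hchild l.level_right_ne_zero
          (ihright ((hT.left_mem_iff_right_mem l).1 h) hlright)
        rw [parent_left] at hleft
        rw [parent_right] at hright
        refine le_mul_add_div_of_le (he.treeErr_nonneg hT l) (by positivity)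
          ((treeErr_eq_min hT h).trans_le (min_le_left _ _)) ?_
        rw [hT.refCount_eq_add h, add_div]
        push_cast
        linarith
      · exact he.treeErr_le_mul_of_penErr_le hS hpen
    · rw [thr_of_left_notMem h, ← hS.penErr_eq_modErr le_rfl (hT.refCount_eq_zero h)] at hl
      exact he.treeErr_le_mul_of_penErr_le hS hl

theorem treeErr_root_le (he : IsLocalError e) (hS : IsRun e S N) :
    treeErr e (S N) root ≤ (2 * N + 1) * thr e S N root := by
  have ht := he.thr_nonneg hS le_rfl root
  have hquot : treeErr e (S N) root / modErr e root ≤ 1 := by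
    rw [modErr_root]
    exact div_le_one_of_le₀ (he.treeErr_le_zero (hS.isTree le_rfl) root) (he.nonneg _ _)
  calc treeErr e (S N) root
      ≤ thr e S N root * (2 * refCount (S N) root + treeErr e (S N) root / modErr e root) :=
        he.treeErr_le_mul_of_thr_le hS ht le_rfl
    _ ≤ thr e S N root * (2 * N + 1) := by
        rw [hS.refCount_root le_rfl]
        gcongr
    _ = (2 * N + 1) * thr e S N root := mul_comm _ _

end IsLocalError

/-! ### Comparison with the best quarklet tree -/

theorem IsTree.refCount_add_one_le_sum {T T' : Finset Node} (hT : IsTree T) (hT' : IsTree T')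
    {l : Node} (hl : l ∈ T') : refCount T l + 1 ≤ ∑ m ∈ leavesBelow T' l, (refCount T m + 1) := by
  induction l using coarsening_induction T' with
  | step l ihleft ihright =>
    by_cases h : l.left ∈ T'
    · have h' := (hT'.left_mem_iff_right_mem l).1 h
      have hsplit : refCount T l ≤ refCount T l.left + refCount T l.right + 1 := by
        by_cases hlT : l.left ∈ T
        · exact (hT.refCount_eq_add hlT).le
        · rw [hT.refCount_eq_zero hlT]
          exact Nat.zero_le _
      rw [sum_leavesBelow _ h]
      linarith [ihleft h h, ihright h' h']
    · rw [leavesBelow_of_mem_leaves (hT'.mem_leaves_iff.2 ⟨hl, h⟩), Finset.sum_singleton]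

variable {top : Node → Node}

theorem le_pmax {T : Finset Node} (P : Node → ℕ) {l m : Node} (hl : l ∈ leaves T)
    (hm : m ∈ Ups top l) : P l ≤ pmax top T P m :=
  Finset.le_sup (f := P) (by simpa only [Finset.mem_filter] using ⟨hl, hm⟩)

namespace IsEnrichment

theorem mem_ups_self (htop : IsEnrichment top) (l : Node) : l ∈ Ups top l :=
  ⟨.refl _, htop.top_ancEq l⟩

theorem sum_leaves_le_qcard (htop : IsEnrichment top) (T : Finset Node) (P : Node → ℕ) :
    ∑ l ∈ leaves T, (P l + 1) ≤ qcard top T P := by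
  rw [Finset.sum_add_distrib, qcard, add_comm, Finset.sum_const, smul_eq_mul, mul_one]
  refine add_le_add (Finset.card_le_card (leaves_subset T)) ?_
  exact (Finset.sum_le_sum fun l hl => le_pmax P hl (htop.mem_ups_self l)).trans
    (Finset.sum_le_sum_of_subset (leaves_subset T))

theorem sub_add_one_le_sum (htop : IsEnrichment top) (hS : IsRun e S N) {T : Finset Node}
    (hT : IsTree T) {P : Node → ℕ} {n : ℕ} (hn : qcard top T P ≤ n) :
    (N : ℝ) - n + 1 ≤ ∑ l ∈ leaves T, ((refCount (S N) l : ℝ) - P l) := by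
  have hN := (hS.isTree le_rfl).refCount_add_one_le_sum hT hT.root_mem
  rw [hS.refCount_root le_rfl, leavesBelow_root, ← Nat.cast_le (α := ℝ)] at hN
  have hP := (htop.sum_leaves_le_qcard T P).trans hn
  rw [← Nat.cast_le (α := ℝ)] at hP
  push_cast [Finset.sum_add_distrib] at hN hP
  rw [Finset.sum_sub_distrib]
  linarith

end IsEnrichment

theorem IsLocalError.mul_thr_root_le_bestErr (he : IsLocalError e) (hS : IsRun e S N)
    (htop : IsEnrichment top) {n : ℕ} (hn : 1 ≤ n) :
    ((N : ℝ) - n + 1) * thr e S N root ≤ bestErr top e n := by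
  have ht := he.thr_nonneg hS le_rfl root
  refine le_csInf ?_ ?_
  · refine ⟨_, {root}, fun _ => 0, IsTree.singleton_root, ?_, rfl⟩
    have hpmax (m : Node) : pmax top {root} (fun _ => 0) m = 0 := Finset.sup_bot _
    simpa [qcard, hpmax] using hn
  · rintro x ⟨T, P, hT, hcard, rfl⟩
    calc ((N : ℝ) - n + 1) * thr e S N root
        ≤ (∑ l ∈ leaves T, ((refCount (S N) l : ℝ) - P l)) * thr e S N root := by
          gcongr
          exact htop.sub_add_one_le_sum hS hT hcard
      _ ≤ globalErr e T P := by
          rw [Finset.sum_mul]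
          exact Finset.sum_le_sum fun l _ => he.mul_thr_root_le hS le_rfl l (P l)

variable {e : ℕ → Node → ℝ} {S : ℕ → Finset Node} {N : ℕ} {T : Finset Node} {top : Node → Node}
  {c : QIdx → ℝ}

/-! ### Trimming -/

theorem mem_trim {l : Node} :
    l ∈ trim e T ↔ l ∈ T ∧ ∀ m ∈ T, m.IsAnc l → treeErr e T m ≠ e (refCount T m) m := by
  simp only [trim, Finset.mem_filter]

theorem IsTree.trim (hT : IsTree T) (e : ℕ → Node → ℝ) : IsTree (trim e T) where
  root_mem := mem_trim.2 ⟨hT.root_mem, fun m _ h => absurd h (not_isAnc_root m)⟩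
  anc_mem l hl m hm := by
    rw [mem_trim] at hl ⊢
    exact ⟨hT.anc_mem _ hl.1 _ hm, fun a ha h => hl.2 a ha (h.trans_isAncEq hm.isAncEq)⟩
  complete l _ := by
    simp only [mem_trim, hT.left_mem_iff_right_mem, isAnc_left_iff, isAnc_right_iff]

theorem treeErr_eq_of_mem_leaves_trim (hT : IsTree T) {l : Node} (hl : l ∈ leaves (trim e T)) :
    treeErr e T l = e (refCount T l) l := by
  obtain ⟨hl, hleft⟩ := (hT.trim e).mem_leaves_iff.1 hl
  by_cases h : l.left ∈ T
  · contrapose! hleft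
    refine mem_trim.2 ⟨h, fun m hm hml => ?_⟩
    rcases isAnc_left_iff.1 hml with hml | rfl
    · exact (mem_trim.1 hl).2 m hm hml
    · exact hleft
  · rw [treeErr_of_left_notMem h, hT.refCount_eq_zero h]

theorem treeErr_eq_add_of_left_mem_trim (hT : IsTree T) {l : Node} (hl : l.left ∈ trim e T) :
    treeErr e T l = treeErr e T l.left + treeErr e T l.right := by
  obtain ⟨hleft, hne⟩ := mem_trim.1 hl
  have hne := hne l (hT.anc_mem _ hleft _ l.isAnc_left) l.isAnc_left
  rw [treeErr_eq_min hT hleft] at hne ⊢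
  exact (min_choice _ _).resolve_right hne

theorem sum_leavesBelow_trim (hT : IsTree T) {l : Node} (hl : l ∈ trim e T) :
    ∑ m ∈ leavesBelow (trim e T) l, e (refCount T m) m = treeErr e T l := by
  have hT' := hT.trim e
  induction l using coarsening_induction (trim e T) with
  | step l ihleft ihright =>
    by_cases h : l.left ∈ trim e T
    · have h' := (hT'.left_mem_iff_right_mem l).1 h
      rw [sum_leavesBelow _ h, ihleft h h, ihright h' h', treeErr_eq_add_of_left_mem_trim hT h]
    · have hleaf := hT'.mem_leaves_iff.2 ⟨hl, h⟩
      rw [leavesBelow_of_mem_leaves hleaf, Finset.sum_singleton,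
        treeErr_eq_of_mem_leaves_trim hT hleaf]

theorem globalErr_trim (hT : IsTree T) :
    globalErr e (trim e T) (refCount T) = treeErr e T root := by
  rw [globalErr, ← leavesBelow_root, sum_leavesBelow_trim hT (hT.trim e).root_mem]

theorem IsLocalError.globalErr_trim_le (he : IsLocalError e) (hS : IsRun e S N)
    (htop : IsEnrichment top) {n : ℕ} (hn : 1 ≤ n) (hnN : n ≤ N) :
    globalErr e (trim e (S N)) (refCount (S N)) ≤
      (2 * N + 1) / ((N : ℝ) - n + 1) * bestErr top e n := by
  have hpos : 0 < (N : ℝ) - n + 1 := by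
    linarith [(Nat.cast_le (α := ℝ)).2 hnN]
  rw [globalErr_trim (hS.isTree le_rfl), div_mul_eq_mul_div, le_div_iff₀ hpos]
  calc treeErr e (S N) root * ((N : ℝ) - n + 1)
      ≤ (2 * N + 1) * thr e S N root * ((N : ℝ) - n + 1) := by
        gcongr
        exact he.treeErr_root_le hS
    _ = (2 * N + 1) * (((N : ℝ) - n + 1) * thr e S N root) := by ring
    _ ≤ (2 * N + 1) * bestErr top e n := by
        gcongr
        exact he.mul_thr_root_le_bestErr hS htop hn

/-! ### The local errors of a coefficient sequence -/

theorem IsTree.left_right_mem_leaves_refine (hT : IsTree T) {l : Node} (hl : l ∈ leaves T) :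
    l.left ∈ leaves (T ∪ {l.left, l.right}) ∧ l.right ∈ leaves (T ∪ {l.left, l.right}) := by
  rw [hT.leaves_refine hl]
  exact ⟨Finset.mem_insert_self _ _, Finset.mem_insert_of_mem (Finset.mem_insert_self _ _)⟩

theorem IsTree.exists_mem_leaves (l : Node) : ∃ T, IsTree T ∧ l ∈ leaves T := by
  induction l using parent_induction with
  | root =>
    refine ⟨{root}, singleton_root, mem_leaves.2 ⟨Finset.mem_singleton_self _, fun m hm => ?_⟩⟩
    rw [Finset.mem_singleton.1 hm]
    exact not_isAnc_root root
  | step l hlevel ih =>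
    obtain ⟨T, hT, hparent⟩ := ih
    obtain ⟨hleft, hright⟩ := hT.left_right_mem_leaves_refine hparent
    refine ⟨_, hT.refine_leaf hparent, ?_⟩
    rcases eq_left_or_eq_right_parent hlevel with h | h <;> rw [h] <;>
      simpa only [parent_left, parent_right]

namespace IsEnrichment

theorem exists_leaf_mem_ups (htop : IsEnrichment top) (hT : IsTree T) {m : Node} (hm : m ∈ T) :
    ∃ l ∈ leaves T, m ∈ Ups top l := by
  rw [← Finset.mem_coe, ← htop.cover T hT] at hm
  simpa only [Set.mem_iUnion, exists_prop] using hm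

theorem disjoint_ups_children (htop : IsEnrichment top) (l : Node) :
    Disjoint (Ups top l.left) (Ups top l.right) := by
  obtain ⟨T, hT, hl⟩ := IsTree.exists_mem_leaves l
  obtain ⟨hleft, hright⟩ := hT.left_right_mem_leaves_refine hl
  exact htop.disjoint _ (hT.refine_leaf hl) _ hleft _ hright (left_ne_right l l)

theorem mem_ups_parent (htop : IsEnrichment top) {l m : Node} (hl : l.level ≠ 0)
    (hm : m ∈ Ups top l) : m ∈ Ups top l.parent ∨ m = l := by
  refine or_iff_not_imp_right.2 fun hml => ?_
  have hmp : m.IsAncEq l.parent := (isAnc_iff_isAncEq_parent hl).1 (hm.1.resolve_right hml)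
  obtain ⟨T, hT, hp⟩ := IsTree.exists_mem_leaves l.parent
  obtain ⟨b, hb, hmb⟩ :=
    htop.exists_leaf_mem_ups hT (hT.mem_of_isAncEq hmp (leaves_subset T hp))
  by_cases hbp : b = l.parent
  · exact hbp ▸ hmb
  have hb' : b ∈ leaves (T ∪ {l.parent.left, l.parent.right}) := by
    rw [hT.leaves_refine hp]
    exact Finset.mem_insert_of_mem (Finset.mem_insert_of_mem (Finset.mem_erase.2 ⟨hbp, hb⟩))
  have hl' : l ∈ leaves (T ∪ {l.parent.left, l.parent.right}) := by
    obtain ⟨hleft, hright⟩ := hT.left_right_mem_leaves_refine hp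
    rcases eq_left_or_eq_right_parent hl with h | h
    · rwa [← h] at hleft ⊢
    · rwa [← h] at hright ⊢
  have hlb : l ≠ b := by
    rintro rfl
    exact (mem_leaves.1 hp).2 l (leaves_subset T hb) (parent_isAnc hl)
  exact absurd hmb (Set.disjoint_left.1 (htop.disjoint _ (hT.refine_leaf hp) l hl' b hb' hlb) hm)

end IsEnrichment

/-- The indices whose coefficients enter the local error `e_p(l)`. -/
def errSet (top : Node → Node) (p : ℕ) (l : Node) : Set QIdx :=
  {x | base x.2 ∈ Ups top l ∧ p < x.1} ∪ {x | l.IsAnc (base x.2)}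

theorem errSet_anti (top : Node → Node) (l : Node) : Antitone fun p => errSet top p l :=
  fun _ _ h => Set.union_subset_union_left _ fun _ hx => ⟨hx.1, h.trans_lt hx.2⟩

theorem localErr_eq_tsum (hc : Summable fun x => |c x| ^ 2) (p : ℕ) (l : Node) :
    localErr top c p l = ∑' x, (errSet top p l).indicator (fun x => |c x| ^ 2) x := by
  have hdisj : Disjoint {x : QIdx | base x.2 ∈ Ups top l ∧ p < x.1} {x | l.IsAnc (base x.2)} :=
    Set.disjoint_left.2 fun x hups hanc => not_isAnc_self l (IsAnc.trans_isAncEq hanc hups.1.1)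
  rw [← tsum_subtype, errSet,
    (hc.subtype _).tsum_union_disjoint (f := fun x => |c x| ^ 2) hdisj (hc.subtype _)]
  rfl

theorem disjoint_errSet_children (htop : IsEnrichment top) (p : ℕ) (l : Node) :
    Disjoint (errSet top p l.left) (errSet top p l.right) := by
  rw [Set.disjoint_left]
  rintro x (⟨hleft, -⟩ | hleft) (⟨hright, -⟩ | hright)
  · exact Set.disjoint_left.1 (htop.disjoint_ups_children l) hleft hright
  · exact lt_irrefl _ (IsAnc.trans_isAncEq hright hleft.1).level_lt
  · exact lt_irrefl _ (IsAnc.trans_isAncEq hleft hright.1).level_lt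
  · exact not_isAncEq_left_and_right l _ ⟨IsAnc.isAncEq hleft, IsAnc.isAncEq hright⟩

theorem errSet_subset_parent (htop : IsEnrichment top) (p : ℕ) {l : Node} (hl : l.level ≠ 0) :
    errSet top p l ⊆ errSet top p l.parent := by
  rintro x (⟨hups, hp⟩ | hanc)
  · rcases htop.mem_ups_parent hl hups with h | h
    · exact .inl ⟨h, hp⟩
    · exact .inr ((parent_isAnc hl).trans_isAncEq (.inr h.symm))
  · exact .inr ((parent_isAnc hl).isAncEq.trans_isAnc hanc)

theorem isLocalError_localErr (htop : IsEnrichment top) (hc : Summable fun x => |c x| ^ 2) :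
    IsLocalError (localErr top c) where
  nonneg p l := by
    rw [localErr_eq_tsum hc]
    exact tsum_nonneg fun x => Set.indicator_nonneg (fun _ _ => sq_nonneg _) x
  anti l p p' h := by
    simp only [localErr_eq_tsum hc]
    exact (hc.indicator _).tsum_le_tsum (Set.indicator_le_indicator_of_subset
      (errSet_anti top l h) fun _ => sq_nonneg _) (hc.indicator _)
  children_le l := by
    have hleft := errSet_subset_parent htop 0 l.level_left_ne_zero
    have hright := errSet_subset_parent htop 0 l.level_right_ne_zero
    rw [parent_left] at hleft
    rw [parent_right] at hright
    simp only [localErr_eq_tsum hc]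
    rw [← (hc.indicator _).tsum_add (hc.indicator _)]
    refine ((hc.indicator _).add (hc.indicator _)).tsum_le_tsum (fun x => ?_) (hc.indicator _)
    rw [← congrFun (Set.indicator_union_of_disjoint (disjoint_errSet_children htop 0 l) _) x]
    exact Set.indicator_le_indicator_of_subset (Set.union_subset hleft hright)
      (fun _ => sq_nonneg _) x

theorem mem_indices {P : Node → ℕ} {x : QIdx} :
    x ∈ indices top T P ↔ (x.2 = none ∨ base x.2 ∈ T) ∧ x.1 ≤ pmax top T P (base x.2) := by
  obtain ⟨p, _ | l⟩ := x
  · simp [indices]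
  · simp [indices, base]

theorem exists_mem_errSet_of_notMem_indices (htop : IsEnrichment top) (hT : IsTree T)
    {P : Node → ℕ} {x : QIdx} (hx : x ∉ indices top T P) :
    ∃ l ∈ leaves T, x ∈ errSet top (P l) l := by
  by_cases h : base x.2 ∈ T
  · obtain ⟨l, hl, hxl⟩ := htop.exists_leaf_mem_ups hT h
    refine ⟨l, hl, .inl ⟨hxl, ?_⟩⟩
    by_contra! hle
    exact hx (mem_indices.2 ⟨.inr h, hle.trans (le_pmax P hl hxl)⟩)
  · obtain ⟨l, hl, hxl⟩ := hT.exists_leaf_isAnc h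
    exact ⟨l, hl, .inr hxl⟩

theorem tsum_compl_indices_le (htop : IsEnrichment top) (hc : Summable fun x => |c x| ^ 2)
    (hT : IsTree T) (P : Node → ℕ) :
    ∑' x, (indices top T P : Set QIdx)ᶜ.indicator (fun x => |c x| ^ 2) x ≤
      globalErr (localErr top c) T P := by
  simp only [globalErr, localErr_eq_tsum hc]
  rw [← Summable.tsum_finsetSum fun l _ => hc.indicator _]
  refine (hc.indicator _).tsum_le_tsum (fun x => ?_) (summable_sum fun l _ => hc.indicator _)
  have hnonneg : ∀ l ∈ leaves T, 0 ≤ (errSet top (P l) l).indicator (fun x => |c x| ^ 2) x :=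
    fun l _ => Set.indicator_nonneg (fun _ _ => sq_nonneg _) x
  by_cases hx : x ∈ indices top T P
  · rw [Set.indicator_of_notMem (Set.notMem_compl_iff.2 hx)]
    exact Finset.sum_nonneg hnonneg
  · obtain ⟨l, hl, hxl⟩ := exists_mem_errSet_of_notMem_indices htop hT hx
    rw [Set.indicator_of_mem (Set.mem_compl hx), ← Set.indicator_of_mem hxl fun x => |c x| ^ 2]
    exact Finset.single_le_sum hnonneg hl

/-! ### The number of indices -/

theorem card_le_of_sup_level (T : Finset Node) :
    T.card ≤ (T.sup Node.level + 1) * 2 ^ T.sup Node.level := by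
  have hcard : T.card ≤
      (Finset.range (T.sup Node.level + 1) ×ˢ Finset.range (2 ^ T.sup Node.level)).card := by
    refine Finset.card_le_card_of_injOn (fun l => (l.level, l.pos)) (fun l hl => ?_)
      fun a _ b _ h => Node.ext (Prod.ext_iff.1 h).1 (Prod.ext_iff.1 h).2
    have hlevel : l.level ≤ T.sup Node.level := Finset.le_sup hl
    have hpos := l.pos_lt.trans_le (Nat.pow_le_pow_right two_pos hlevel)
    exact Finset.mem_product.2
      ⟨Finset.mem_range.2 (Nat.lt_succ_of_le hlevel), Finset.mem_range.2 hpos⟩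
  simpa only [Finset.card_product, Finset.card_range] using hcard

theorem card_indices_le (top : Node → Node) (T : Finset Node) {P : Node → ℕ} {M : ℕ}
    (hP : ∀ l, P l ≤ M) : (indices top T P).card ≤ (T.card + 1) * (M + 1) := by
  rw [indices, ← Finset.card_insertNone]
  refine Finset.card_biUnion_le_card_mul _ _ _ fun a _ => Finset.card_image_le.trans ?_
  rw [Finset.card_range]
  exact Nat.succ_le_succ (Finset.sup_le fun l _ => hP l)

theorem refCount_le_refCount_root (T : Finset Node) (l : Node) :
    refCount T l ≤ refCount T root := by
  rw [refCount_eq_card_leavesBelow, refCount_eq_card_leavesBelow, leavesBelow_root]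
  exact Nat.sub_le_sub_right
    (Finset.card_le_card fun m hm => (mem_leavesBelow.1 hm).1) 1

theorem IsRun.card_indices_trim_le (hS : IsRun e S N) (hN : 1 ≤ N) (top : Node → Node) :
    (indices top (trim e (S N)) (refCount (S N))).card ≤
      2 * (((trim e (S N)).sup Node.level + 1) * 2 ^ (trim e (S N)).sup Node.level + 1) * N := by
  set L := (trim e (S N)).sup Node.level
  have hP (l : Node) : refCount (S N) l ≤ N :=
    (refCount_le_refCount_root _ l).trans_eq (hS.refCount_root le_rfl)
  calc (indices top (trim e (S N)) (refCount (S N))).card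
      ≤ ((trim e (S N)).card + 1) * (N + 1) := card_indices_le top _ hP
    _ ≤ ((L + 1) * 2 ^ L + 1) * (2 * N) :=
        Nat.mul_le_mul (Nat.succ_le_succ (card_le_of_sup_level _)) (by omega)
    _ = 2 * ((L + 1) * 2 ^ L + 1) * N := by ring

/-! ### Quarklets as differences of dilated quarks -/

theorem quark_nonneg (p : ℕ) (x : ℝ) : 0 ≤ quark p x :=
  Set.indicator_nonneg (fun _ hx => pow_nonneg hx.1 p) x

theorem integrable_quark (p : ℕ) : Integrable (quark p) :=
  (integrable_indicator_iff measurableSet_Ico).2 <|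
    (continuous_pow p).integrableOn_Icc.mono_set Set.Ico_subset_Icc_self

theorem integral_quark (p : ℕ) : ∫ x, quark p x = ((p : ℝ) + 1)⁻¹ := by
  rw [quark, integral_indicator measurableSet_Ico, integral_Ico_eq_integral_Ioc,
    ← intervalIntegral.integral_of_le zero_le_one, integral_pow]
  simp

theorem interval_subset_Icc (a : Node) : a.interval ⊆ Set.Icc 0 1 :=
  (isAncEq_iff_subset.1 a.root_isAncEq).trans <| by
    simp [root, interval, Set.Ico_subset_Icc_self]

/-- The quark `φ_p` transported from `[0, 1)` to the dyadic interval of `a`, without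
normalization. It describes one half of the quarklets of the parent of `a`. -/
noncomputable def dilatedQuark (p : ℕ) (a : Node) (t : ℝ) : ℝ := quark p (2 ^ a.level * t - a.pos)

theorem dilatedQuark_eq_indicator (p : ℕ) (a : Node) :
    dilatedQuark p a = a.interval.indicator fun t => (2 ^ a.level * t - a.pos) ^ p := by
  have hpos : (0 : ℝ) < 2 ^ a.level := by positivity
  ext t
  rw [dilatedQuark, quark, ← Set.indicator_comp_right fun t => 2 ^ a.level * t - (a.pos : ℝ)]
  congr 1
  ext t
  rw [interval, Set.mem_preimage, Set.mem_Ico, Set.mem_Ico, div_le_iff₀' hpos, lt_div_iff₀' hpos,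
    sub_nonneg, sub_lt_iff_lt_add']

theorem dilatedQuark_of_notMem {p : ℕ} {a : Node} {t : ℝ} (ht : t ∉ a.interval) :
    dilatedQuark p a t = 0 := by
  rw [dilatedQuark_eq_indicator, Set.indicator_of_notMem ht]

theorem dilatedQuark_nonneg (p : ℕ) (a : Node) (t : ℝ) : 0 ≤ dilatedQuark p a t :=
  quark_nonneg _ _

theorem dilatedQuark_le_one (p : ℕ) (a : Node) (t : ℝ) : dilatedQuark p a t ≤ 1 :=
  (le_abs_self _).trans (abs_quark_le _ _)

theorem integrable_dilatedQuark (p : ℕ) (a : Node) : Integrable (dilatedQuark p a) muI :=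
  (((integrable_quark p).comp_sub_right (a.pos : ℝ)).comp_mul_left' (by positivity)).integrableOn

theorem integral_dilatedQuark (p : ℕ) (a : Node) :
    ∫ t, dilatedQuark p a t ∂muI = (2 ^ a.level)⁻¹ * ((p : ℝ) + 1)⁻¹ := by
  rw [setIntegral_eq_integral_of_forall_compl_eq_zero fun t ht =>
    dilatedQuark_of_notMem fun h => ht (interval_subset_Icc a h)]
  simp only [dilatedQuark]
  rw [Measure.integral_comp_mul_left (fun x => quark p (x - a.pos)) (2 ^ a.level),
    integral_sub_right_eq_self (quark p), integral_quark, abs_of_nonneg (by positivity),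
    smul_eq_mul]

theorem quarkletFun_none (p : ℕ) : quarkletFun (p, none) = dilatedQuark p root := by
  ext t
  simp [quarkletFun, dilatedQuark, root]

theorem two_rpow_half (j : ℕ) : (2 : ℝ) ^ ((j : ℝ) / 2) = √2 ^ j := by
  rw [Real.sqrt_eq_rpow, ← Real.rpow_mul_natCast zero_le_two]
  ring_nf

theorem quarkletFun_some (p : ℕ) (l : Node) (t : ℝ) :
    quarkletFun (p, some l) t =
      √2 ^ l.level * (dilatedQuark p l.left t - dilatedQuark p l.right t) := by
  rw [quarkletFun, two_rpow_half, quarklet, dilatedQuark, dilatedQuark]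
  simp only [left, right, pow_succ', Nat.cast_add, Nat.cast_mul, Nat.cast_ofNat, Nat.cast_one]
  ring_nf

theorem quarkletFun_eq_zero {p : ℕ} {l : Node} {t : ℝ} (ht : t ∉ l.interval) :
    quarkletFun (p, some l) t = 0 := by
  have hleft : t ∉ l.left.interval := fun h => ht (isAncEq_iff_subset.1 l.isAnc_left.isAncEq h)
  have hright : t ∉ l.right.interval := fun h => ht (isAncEq_iff_subset.1 l.isAnc_right.isAncEq h)
  rw [quarkletFun_some, dilatedQuark_of_notMem hleft, dilatedQuark_of_notMem hright, sub_zero,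
    mul_zero]

theorem abs_quarkletFun_le (p : ℕ) (l : Node) (t : ℝ) :
    |quarkletFun (p, some l) t| ≤ √2 ^ l.level := by
  rw [quarkletFun_some, abs_mul, abs_of_nonneg (by positivity)]
  refine mul_le_of_le_one_right (by positivity) (abs_sub_le_of_nonneg_of_le ?_ ?_ ?_ ?_)
  all_goals first | exact dilatedQuark_nonneg _ _ _ | exact dilatedQuark_le_one _ _ _

theorem integral_quarkletFun (p : ℕ) (l : Node) : ∫ t, quarkletFun (p, some l) t ∂muI = 0 := by
  simp only [quarkletFun_some]
  rw [integral_const_mul, integral_sub (integrable_dilatedQuark _ _) (integrable_dilatedQuark _ _),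
    integral_dilatedQuark, integral_dilatedQuark]
  simp only [left, right, sub_self, mul_zero]

theorem integrable_quarkletFun (x : QIdx) : Integrable (quarkletFun x) muI :=
  (memLp_quarkletFun x).integrable one_le_two

theorem integral_abs_quarkletFun_le (p : ℕ) (l : Node) :
    ∫ t, |quarkletFun (p, some l) t| ∂muI ≤ (√2)⁻¹ ^ l.level * ((p : ℝ) + 1)⁻¹ := by
  have hleft := integrable_dilatedQuark p l.left
  have hright := integrable_dilatedQuark p l.right
  have hsqrt : √2 ^ l.level * √2 ^ l.level = (2 : ℝ) ^ l.level := by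
    rw [← mul_pow, Real.mul_self_sqrt zero_le_two]
  calc ∫ t, |quarkletFun (p, some l) t| ∂muI
      ≤ ∫ t, √2 ^ l.level * (dilatedQuark p l.left t + dilatedQuark p l.right t) ∂muI := by
        refine integral_mono (integrable_quarkletFun _).abs ((hleft.add hright).const_mul _)
          fun t => ?_
        simp only [quarkletFun_some, abs_mul, abs_of_nonneg (show 0 ≤ √2 ^ l.level by positivity)]
        gcongr
        refine (abs_sub _ _).trans_eq ?_
        rw [abs_of_nonneg (dilatedQuark_nonneg _ _ _), abs_of_nonneg (dilatedQuark_nonneg _ _ _)]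
    _ = (√2)⁻¹ ^ l.level * ((p : ℝ) + 1)⁻¹ := by
        rw [integral_const_mul, integral_add hleft hright, integral_dilatedQuark,
          integral_dilatedQuark]
        simp only [left, right]
        rw [pow_succ, ← hsqrt, inv_pow]
        field_simp
        norm_num

theorem integrable_quarkletFun_mul (x y : QIdx) :
    Integrable (fun t => quarkletFun x t * quarkletFun y t) muI :=
  (memLp_quarkletFun x).integrable_mul (memLp_quarkletFun y)

theorem inner_quarkletL2 (x y : QIdx) :
    inner ℝ (quarkletL2 x) (quarkletL2 y) = ∫ t, quarkletFun x t * quarkletFun y t ∂muI := by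
  rw [L2.inner_def]
  refine integral_congr_ae ?_
  filter_upwards [(memLp_quarkletFun x).coeFn_toLp, (memLp_quarkletFun y).coeFn_toLp] with t hx hy
  rw [quarkletL2, quarkletL2, hx, hy, RCLike.inner_apply, conj_trivial, mul_comm]

theorem norm_quarkletL2_none_sq_le (p : ℕ) : ‖quarkletL2 (p, none)‖ ^ 2 ≤ ((p : ℝ) + 1)⁻¹ := by
  rw [← real_inner_self_eq_norm_sq, inner_quarkletL2]
  calc ∫ t, quarkletFun (p, none) t * quarkletFun (p, none) t ∂muI
      ≤ ∫ t, dilatedQuark p root t ∂muI := by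
        refine integral_mono (integrable_quarkletFun_mul _ _) (integrable_dilatedQuark p root)
          fun t => ?_
        rw [quarkletFun_none]
        exact mul_le_of_le_one_right (dilatedQuark_nonneg _ _ t) (dilatedQuark_le_one _ _ t)
    _ = ((p : ℝ) + 1)⁻¹ := by
        rw [integral_dilatedQuark, root, pow_zero, inv_one, one_mul]

/-! ### Almost orthogonality of quarklets of a fixed degree -/

theorem eq_of_mem_interval {l m : Node} {t : ℝ} (hlevel : l.level = m.level)
    (hl : t ∈ l.interval) (hm : t ∈ m.interval) : l = m := by
  rw [mem_interval_iff] at hl hm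
  rw [hlevel, hm, Nat.cast_inj] at hl
  exact Node.ext hlevel hl.symm

theorem sum_abs_quarkletFun_le (p : ℕ) {j : ℕ} {F : Finset Node} (hF : ∀ m ∈ F, m.level = j)
    (t : ℝ) : ∑ m ∈ F, |quarkletFun (p, some m) t| ≤ √2 ^ j := by
  by_cases h : ∃ m ∈ F, t ∈ m.interval
  · obtain ⟨m, hm, ht⟩ := h
    rw [Finset.sum_eq_single_of_mem m hm fun a ha hne => ?_]
    · exact hF m hm ▸ abs_quarkletFun_le p m t
    · rw [quarkletFun_eq_zero, abs_zero]
      exact fun h => hne (eq_of_mem_interval ((hF a ha).trans (hF m hm).symm) h ht)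
  · push Not at h
    rw [Finset.sum_eq_zero fun m hm => by rw [quarkletFun_eq_zero (h m hm), abs_zero]]
    positivity

theorem sum_abs_inner_coarse_le (p : ℕ) {j : ℕ} (l : Node) {F : Finset Node}
    (hF : ∀ m ∈ F, m.level = j) :
    ∑ m ∈ F, |inner ℝ (quarkletL2 (p, some l)) (quarkletL2 (p, some m))| ≤
      √2 ^ j * ((√2)⁻¹ ^ l.level * ((p : ℝ) + 1)⁻¹) := by
  have hint (m : Node) : Integrable
      (fun t => |quarkletFun (p, some l) t * quarkletFun (p, some m) t|) muI :=
    (integrable_quarkletFun_mul _ _).abs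
  simp only [inner_quarkletL2]
  calc ∑ m ∈ F, |∫ t, quarkletFun (p, some l) t * quarkletFun (p, some m) t ∂muI|
      ≤ ∑ m ∈ F, ∫ t, |quarkletFun (p, some l) t * quarkletFun (p, some m) t| ∂muI :=
        Finset.sum_le_sum fun m _ => abs_integral_le_integral_abs
    _ = ∫ t, ∑ m ∈ F, |quarkletFun (p, some l) t * quarkletFun (p, some m) t| ∂muI :=
        (integral_finsetSum F fun m _ => hint m).symm
    _ ≤ ∫ t, √2 ^ j * |quarkletFun (p, some l) t| ∂muI := by
        refine integral_mono (integrable_finsetSum F fun m _ => hint m)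
          ((integrable_quarkletFun _).abs.const_mul _) fun t => ?_
        simp only [abs_mul]
        rw [← Finset.mul_sum, mul_comm]
        exact mul_le_mul_of_nonneg_right (sum_abs_quarkletFun_le p hF t) (abs_nonneg _)
    _ ≤ √2 ^ j * ((√2)⁻¹ ^ l.level * ((p : ℝ) + 1)⁻¹) := by
        rw [integral_const_mul]
        gcongr
        exact integral_abs_quarkletFun_le p l

/-- The monotone function with values in `[0, 1]` that agrees with `dilatedQuark p a` on the dyadic
interval of `a`. Its increments bound the oscillation of `dilatedQuark p a` on finer dyadic
intervals, on which the jumps of `dilatedQuark p a` are not seen. -/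
noncomputable def dilatedRamp (p : ℕ) (a : Node) (t : ℝ) : ℝ :=
  max 0 (min (2 ^ a.level * t - a.pos) 1) ^ p

theorem monotone_dilatedRamp (p : ℕ) (a : Node) : Monotone (dilatedRamp p a) := fun s t hst => by
  unfold dilatedRamp
  gcongr

theorem dilatedRamp_nonneg (p : ℕ) (a : Node) (t : ℝ) : 0 ≤ dilatedRamp p a t :=
  pow_nonneg (le_max_left _ _) p

theorem dilatedRamp_le_one (p : ℕ) (a : Node) (t : ℝ) : dilatedRamp p a t ≤ 1 :=
  pow_le_one₀ (le_max_left _ _) (max_le zero_le_one (min_le_right _ _))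

theorem dilatedQuark_of_mem (p : ℕ) {a : Node} {t : ℝ} (ht : t ∈ a.interval) :
    dilatedQuark p a t = dilatedRamp p a t := by
  have hpos : (0 : ℝ) < 2 ^ a.level := by positivity
  rw [dilatedQuark_eq_indicator, Set.indicator_of_mem ht, dilatedRamp, min_eq_left, max_eq_right]
  · exact sub_nonneg.2 ((div_le_iff₀' hpos).1 ht.1)
  · exact (sub_lt_iff_lt_add'.2 ((lt_div_iff₀' hpos).1 ht.2)).le

theorem abs_dilatedQuark_sub_le (p : ℕ) {a m : Node} (ham : a.level ≤ m.level) {t : ℝ}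
    (ht : t ∈ m.interval) :
    |dilatedQuark p a t - dilatedQuark p a (m.pos / 2 ^ m.level)| ≤
      dilatedRamp p a ((m.pos + 1) / 2 ^ m.level) - dilatedRamp p a (m.pos / 2 ^ m.level) := by
  obtain ⟨i, hi⟩ := Nat.exists_eq_add_of_le ham
  have hs := m.left_endpoint_mem_interval
  have hiff : t ∈ a.interval ↔ (m.pos / 2 ^ m.level : ℝ) ∈ a.interval := by
    rw [mem_interval_iff_div_eq hi ht, mem_interval_iff_div_eq hi hs]
  have hmono := monotone_dilatedRamp p a
  by_cases ha : t ∈ a.interval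
  · rw [dilatedQuark_of_mem p ha, dilatedQuark_of_mem p (hiff.1 ha),
      abs_of_nonneg (sub_nonneg.2 (hmono ht.1))]
    exact sub_le_sub_right (hmono ht.2.le) _
  · rw [dilatedQuark_of_notMem ha, dilatedQuark_of_notMem (mt hiff.2 ha), sub_zero, abs_zero]
    exact sub_nonneg.2 (hmono (ht.1.trans ht.2.le))

/-- A monotone function of total increment at most `2 ^ (1 + l.level / 2)` whose increments bound
the oscillation of the quarklet `ψ_{p,l}` on finer dyadic intervals. -/
noncomputable def variation (p : ℕ) (l : Node) (t : ℝ) : ℝ :=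
  √2 ^ l.level * (dilatedRamp p l.left t + dilatedRamp p l.right t)

theorem monotone_variation (p : ℕ) (l : Node) : Monotone (variation p l) :=
  ((monotone_dilatedRamp p l.left).add (monotone_dilatedRamp p l.right)).const_mul (by positivity)

theorem variation_nonneg (p : ℕ) (l : Node) (t : ℝ) : 0 ≤ variation p l t :=
  mul_nonneg (by positivity) (add_nonneg (dilatedRamp_nonneg _ _ _) (dilatedRamp_nonneg _ _ _))

theorem variation_le (p : ℕ) (l : Node) (t : ℝ) : variation p l t ≤ √2 ^ l.level * 2 := by
  refine mul_le_mul_of_nonneg_left ?_ (by positivity)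
  linarith [dilatedRamp_le_one p l.left t, dilatedRamp_le_one p l.right t]

theorem abs_quarkletFun_sub_le (p : ℕ) {l m : Node} (hlm : l.level < m.level) {t : ℝ}
    (ht : t ∈ m.interval) :
    |quarkletFun (p, some l) t - quarkletFun (p, some l) (m.pos / 2 ^ m.level)| ≤
      variation p l ((m.pos + 1) / 2 ^ m.level) - variation p l (m.pos / 2 ^ m.level) := by
  have hleft := abs_dilatedQuark_sub_le p (a := l.left) hlm ht
  have hright := abs_dilatedQuark_sub_le p (a := l.right) hlm ht
  rw [quarkletFun_some, quarkletFun_some, ← mul_sub, abs_mul, abs_of_nonneg (by positivity),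
    variation, variation, ← mul_sub, sub_sub_sub_comm, add_sub_add_comm]
  gcongr
  exact (abs_sub _ _).trans (add_le_add hleft hright)

theorem inner_eq_integral_sub_mul (x : QIdx) (m : Node) (κ : ℝ) :
    inner ℝ (quarkletL2 x) (quarkletL2 (x.1, some m)) =
      ∫ t, (quarkletFun x t - κ) * quarkletFun (x.1, some m) t ∂muI := by
  simp only [sub_mul]
  rw [inner_quarkletL2, integral_sub (integrable_quarkletFun_mul _ _)
    ((integrable_quarkletFun _).const_mul κ), integral_const_mul, integral_quarkletFun, mul_zero,
    sub_zero]

theorem abs_inner_fine_le (p : ℕ) {l m : Node} (hlm : l.level < m.level) :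
    |inner ℝ (quarkletL2 (p, some l)) (quarkletL2 (p, some m))| ≤
      (variation p l ((m.pos + 1) / 2 ^ m.level) - variation p l (m.pos / 2 ^ m.level)) *
        ((√2)⁻¹ ^ m.level * ((p : ℝ) + 1)⁻¹) := by
  set V := variation p l ((m.pos + 1) / 2 ^ m.level) - variation p l (m.pos / 2 ^ m.level)
  set κ := quarkletFun (p, some l) (m.pos / 2 ^ m.level)
  have hV : 0 ≤ V := sub_nonneg.2 (monotone_variation p l (by gcongr; linarith))
  have hpoint (t : ℝ) : |(quarkletFun (p, some l) t - κ) * quarkletFun (p, some m) t| ≤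
      V * |quarkletFun (p, some m) t| := by
    rw [abs_mul]
    by_cases ht : t ∈ m.interval
    · exact mul_le_mul_of_nonneg_right (abs_quarkletFun_sub_le p hlm ht) (abs_nonneg _)
    · rw [quarkletFun_eq_zero ht, abs_zero, mul_zero, mul_zero]
  calc |inner ℝ (quarkletL2 (p, some l)) (quarkletL2 (p, some m))|
      ≤ ∫ t, V * |quarkletFun (p, some m) t| ∂muI := by
        rw [inner_eq_integral_sub_mul (p, some l) m κ, ← Real.norm_eq_abs]
        exact norm_integral_le_of_norm_le ((integrable_quarkletFun _).abs.const_mul V)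
          (ae_of_all _ hpoint)
    _ ≤ V * ((√2)⁻¹ ^ m.level * ((p : ℝ) + 1)⁻¹) := by
        rw [integral_const_mul]
        gcongr
        exact integral_abs_quarkletFun_le p m

theorem sum_abs_inner_fine_le (p : ℕ) {j : ℕ} {l : Node} (hj : l.level < j) {F : Finset Node}
    (hF : ∀ m ∈ F, m.level = j) :
    ∑ m ∈ F, |inner ℝ (quarkletL2 (p, some l)) (quarkletL2 (p, some m))| ≤
      √2 ^ l.level * 2 * ((√2)⁻¹ ^ j * ((p : ℝ) + 1)⁻¹) := by
  let V (k : ℕ) : ℝ := variation p l (k / 2 ^ j)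
  have hV (k : ℕ) : 0 ≤ V (k + 1) - V k :=
    sub_nonneg.2 (monotone_variation p l (by gcongr; linarith))
  have hincrements : ∑ m ∈ F, (V (m.pos + 1) - V m.pos) ≤ √2 ^ l.level * 2 := by
    have hinj : Set.InjOn Node.pos F := fun a ha b hb h =>
      Node.ext ((hF a ha).trans (hF b hb).symm) h
    calc ∑ m ∈ F, (V (m.pos + 1) - V m.pos)
        = ∑ k ∈ F.image Node.pos, (V (k + 1) - V k) :=
          (Finset.sum_image (f := fun k => V (k + 1) - V k) hinj).symm
      _ ≤ ∑ k ∈ Finset.range (2 ^ j), (V (k + 1) - V k) := by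
          refine Finset.sum_le_sum_of_subset_of_nonneg (Finset.image_subset_iff.2 fun m hm => ?_)
            fun k _ _ => hV k
          exact Finset.mem_range.2 (hF m hm ▸ m.pos_lt)
      _ = V (2 ^ j) - V 0 := Finset.sum_range_sub V _
      _ ≤ √2 ^ l.level * 2 :=
          (sub_le_self _ (variation_nonneg _ _ _)).trans (variation_le _ _ _)
  calc ∑ m ∈ F, |inner ℝ (quarkletL2 (p, some l)) (quarkletL2 (p, some m))|
      ≤ ∑ m ∈ F, (V (m.pos + 1) - V m.pos) * ((√2)⁻¹ ^ j * ((p : ℝ) + 1)⁻¹) := by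
        refine Finset.sum_le_sum fun m hm => ?_
        obtain rfl := hF m hm
        simpa only [V, Nat.cast_add, Nat.cast_one] using abs_inner_fine_le p hj
    _ ≤ √2 ^ l.level * 2 * ((√2)⁻¹ ^ j * ((p : ℝ) + 1)⁻¹) := by
        rw [← Finset.sum_mul]
        gcongr

theorem sum_pow_dist_le {r : ℝ} (hr : 0 ≤ r) (hr' : r < 1) (j M : ℕ) :
    ∑ i ∈ Finset.range M, r ^ Nat.dist j i ≤ 2 * (1 - r)⁻¹ := by
  have hgeom (n : ℕ) : ∑ i ∈ Finset.range n, r ^ i ≤ (1 - r)⁻¹ :=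
    tsum_geometric_of_lt_one hr hr' ▸
      (summable_geometric_of_lt_one hr hr').sum_le_tsum _ fun i _ => pow_nonneg hr i
  have hbelow : ∑ i ∈ Finset.range (j + 1), r ^ Nat.dist j i =
      ∑ i ∈ Finset.range (j + 1), r ^ i := by
    rw [← Finset.sum_range_reflect]
    refine Finset.sum_congr rfl fun i hi => ?_
    rw [Finset.mem_range] at hi
    rw [Nat.dist]
    congr 1
    omega
  have habove : ∑ i ∈ Finset.range M, r ^ Nat.dist j (j + 1 + i) ≤ ∑ i ∈ Finset.range M, r ^ i :=
    Finset.sum_le_sum fun i _ => pow_le_pow_of_le_one hr hr'.le (by rw [Nat.dist]; omega)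
  calc ∑ i ∈ Finset.range M, r ^ Nat.dist j i
      ≤ ∑ i ∈ Finset.range (j + 1 + M), r ^ Nat.dist j i :=
        Finset.sum_le_sum_of_subset_of_nonneg (Finset.range_subset_range.2 (by omega))
          fun i _ _ => pow_nonneg hr _
    _ ≤ 2 * (1 - r)⁻¹ := by
        rw [Finset.sum_range_add, hbelow, two_mul]
        exact add_le_add (hgeom _) (habove.trans (hgeom _))

theorem inv_sqrt_two_le : (√2)⁻¹ ≤ (3 / 4 : ℝ) :=
  (inv_anti₀ (by norm_num) (Real.le_sqrt_of_sq_le (by norm_num : (4 / 3 : ℝ) ^ 2 ≤ 2))).trans_eq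
    (by norm_num)

theorem sum_abs_inner_level_le (p : ℕ) {j : ℕ} (l : Node) {F : Finset Node}
    (hF : ∀ m ∈ F, m.level = j) :
    ∑ m ∈ F, |inner ℝ (quarkletL2 (p, some l)) (quarkletL2 (p, some m))| ≤
      2 * ((p : ℝ) + 1)⁻¹ * (√2)⁻¹ ^ Nat.dist l.level j := by
  have hpow (i k : ℕ) : √2 ^ i * (√2)⁻¹ ^ (i + k) = (√2)⁻¹ ^ k := by
    rw [pow_add, ← mul_assoc, ← mul_pow, mul_inv_cancel₀ (by positivity), one_pow, one_mul]
  rcases lt_or_ge l.level j with hlj | hjl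
  · obtain ⟨k, hk⟩ := Nat.exists_eq_add_of_le hlj.le
    calc _ ≤ √2 ^ l.level * 2 * ((√2)⁻¹ ^ j * ((p : ℝ) + 1)⁻¹) := sum_abs_inner_fine_le p hlj hF
      _ = 2 * ((p : ℝ) + 1)⁻¹ * (√2 ^ l.level * (√2)⁻¹ ^ (l.level + k)) := by rw [← hk]; ring
      _ = _ := by rw [hpow, hk, Nat.dist_eq_sub_of_le (by omega), Nat.add_sub_cancel_left]
  · obtain ⟨k, hk⟩ := Nat.exists_eq_add_of_le hjl
    calc _ ≤ √2 ^ j * ((√2)⁻¹ ^ l.level * ((p : ℝ) + 1)⁻¹) := sum_abs_inner_coarse_le p l hF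
      _ = ((p : ℝ) + 1)⁻¹ * (√2 ^ j * (√2)⁻¹ ^ (j + k)) := by rw [← hk]; ring
      _ ≤ 2 * ((p : ℝ) + 1)⁻¹ * (√2)⁻¹ ^ Nat.dist l.level j := by
          rw [hpow, hk, Nat.dist_eq_sub_of_le_right (by omega), Nat.add_sub_cancel_left]
          gcongr
          exact le_mul_of_one_le_left (by positivity) one_le_two

theorem sum_abs_inner_le (p : ℕ) (l : Node) (F : Finset Node) :
    ∑ m ∈ F, |inner ℝ (quarkletL2 (p, some l)) (quarkletL2 (p, some m))| ≤
      16 * ((p : ℝ) + 1)⁻¹ := by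
  have hlevel (m : Node) (hm : m ∈ F) : m.level ∈ Finset.range (F.sup Node.level + 1) :=
    Finset.mem_range.2 (Nat.lt_succ_of_le (Finset.le_sup (f := Node.level) hm))
  have hdist : ∑ j ∈ Finset.range (F.sup Node.level + 1), (√2)⁻¹ ^ Nat.dist l.level j ≤ 8 := by
    have hle := inv_sqrt_two_le
    calc _ ≤ 2 * (1 - (√2)⁻¹)⁻¹ := sum_pow_dist_le (by positivity) (by linarith) _ _
      _ ≤ 2 * (1 / 4)⁻¹ := by gcongr; linarith
      _ = 8 := by norm_num
  rw [← Finset.sum_fiberwise_of_maps_to hlevel]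
  calc _ ≤ ∑ j ∈ Finset.range (F.sup Node.level + 1),
        2 * ((p : ℝ) + 1)⁻¹ * (√2)⁻¹ ^ Nat.dist l.level j :=
        Finset.sum_le_sum fun j _ =>
          sum_abs_inner_level_le p l fun m hm => (Finset.mem_filter.1 hm).2
    _ ≤ 2 * ((p : ℝ) + 1)⁻¹ * 8 := by
        rw [← Finset.mul_sum]
        gcongr
    _ = 16 * ((p : ℝ) + 1)⁻¹ := by ring

/-! ### Stability of quarklet expansions -/

theorem sum_mul_mul_le_of_sum_abs_le {ι : Type*} {F : Finset ι} {G : ι → ι → ℝ}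
    (hsymm : ∀ i k, G i k = G k i) {B : ℝ} (hB : ∀ i ∈ F, ∑ k ∈ F, |G i k| ≤ B) (d : ι → ℝ) :
    ∑ i ∈ F, ∑ k ∈ F, d i * d k * G i k ≤ B * ∑ i ∈ F, d i ^ 2 := by
  have hterm (i k : ι) : d i * d k * G i k ≤ (d i ^ 2 * |G i k| + d k ^ 2 * |G k i|) / 2 := by
    have hyoung : |d i * d k| ≤ (d i ^ 2 + d k ^ 2) / 2 :=
      abs_le.2 ⟨by linarith [sq_nonneg (d i + d k)], by linarith [sq_nonneg (d i - d k)]⟩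
    calc d i * d k * G i k ≤ |d i * d k| * |G i k| := (le_abs_self _).trans_eq (abs_mul _ _)
      _ ≤ (d i ^ 2 + d k ^ 2) / 2 * |G i k| := by gcongr
      _ = (d i ^ 2 * |G i k| + d k ^ 2 * |G k i|) / 2 := by rw [hsymm k i]; ring
  calc ∑ i ∈ F, ∑ k ∈ F, d i * d k * G i k
      ≤ ∑ i ∈ F, ∑ k ∈ F, (d i ^ 2 * |G i k| + d k ^ 2 * |G k i|) / 2 :=
        Finset.sum_le_sum fun i _ => Finset.sum_le_sum fun k _ => hterm i k
    _ = ∑ i ∈ F, d i ^ 2 * ∑ k ∈ F, |G i k| := by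
        simp only [← Finset.sum_div, Finset.sum_add_distrib]
        rw [Finset.sum_comm (f := fun i k => d k ^ 2 * |G k i|), add_self_div_two]
        simp only [Finset.mul_sum]
    _ ≤ ∑ i ∈ F, d i ^ 2 * B :=
        Finset.sum_le_sum fun i hi => mul_le_mul_of_nonneg_left (hB i hi) (sq_nonneg _)
    _ = B * ∑ i ∈ F, d i ^ 2 := by rw [← Finset.sum_mul, mul_comm]

theorem norm_sum_smul_sq_le_of_sum_abs_inner_le {ι H : Type*} [SeminormedAddCommGroup H]
    [InnerProductSpace ℝ H] {F : Finset ι} {v : ι → H} {B : ℝ}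
    (hB : ∀ i ∈ F, ∑ k ∈ F, |inner ℝ (v i) (v k)| ≤ B) (d : ι → ℝ) :
    ‖∑ i ∈ F, d i • v i‖ ^ 2 ≤ B * ∑ i ∈ F, d i ^ 2 := by
  have hexpand : ‖∑ i ∈ F, d i • v i‖ ^ 2 = ∑ i ∈ F, ∑ k ∈ F, d i * d k * inner ℝ (v i) (v k) := by
    simp only [← real_inner_self_eq_norm_sq, sum_inner, real_inner_smul_left]
    simp only [inner_sum, real_inner_smul_right, Finset.mul_sum, mul_assoc]
  rw [hexpand]
  exact sum_mul_mul_le_of_sum_abs_le (fun i k => real_inner_comm _ _) hB d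

theorem norm_sum_quarkletL2_sq_le (p : ℕ) (d : Option Node → ℝ) (B : Finset (Option Node)) :
    ‖∑ a ∈ B, d a • quarkletL2 (p, a)‖ ^ 2 ≤ 32 * ((p : ℝ) + 1)⁻¹ * ∑ a ∈ B, d a ^ 2 := by
  have hwavelets : ‖∑ a ∈ B.erase none, d a • quarkletL2 (p, a)‖ ^ 2 ≤
      16 * ((p : ℝ) + 1)⁻¹ * ∑ a ∈ B.erase none, d a ^ 2 := by
    rw [← Finset.map_some_eraseNone, Finset.sum_map, Finset.sum_map]
    exact norm_sum_smul_sq_le_of_sum_abs_inner_le (fun l _ => sum_abs_inner_le p l _) _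
  by_cases hB : none ∈ B
  · have hquark : ‖d none • quarkletL2 (p, none)‖ ^ 2 ≤ ((p : ℝ) + 1)⁻¹ * d none ^ 2 := by
      rw [norm_smul, mul_pow, Real.norm_eq_abs, sq_abs, mul_comm]
      gcongr
      exact norm_quarkletL2_none_sq_le p
    rw [← Finset.add_sum_erase B _ hB, ← Finset.add_sum_erase B _ hB]
    calc _ ≤ (‖d none • quarkletL2 (p, none)‖ +
            ‖∑ a ∈ B.erase none, d a • quarkletL2 (p, a)‖) ^ 2 := by
          gcongr
          exact norm_add_le _ _
      _ ≤ 2 * (‖d none • quarkletL2 (p, none)‖ ^ 2 +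
            ‖∑ a ∈ B.erase none, d a • quarkletL2 (p, a)‖ ^ 2) := add_sq_le
      _ ≤ 2 * (16 * (((p : ℝ) + 1)⁻¹ * d none ^ 2) +
            16 * ((p : ℝ) + 1)⁻¹ * ∑ a ∈ B.erase none, d a ^ 2) := by
          gcongr
          exact hquark.trans (le_mul_of_one_le_left (by positivity) (by norm_num))
      _ = 32 * ((p : ℝ) + 1)⁻¹ * (d none ^ 2 + ∑ a ∈ B.erase none, d a ^ 2) := by ring
  · rw [Finset.erase_eq_of_notMem hB] at hwavelets
    refine hwavelets.trans ?_
    gcongr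
    norm_num

theorem norm_partialSum_sq_le {w : ℕ → ℝ} (hw : Summable fun p : ℕ => w p ^ 2 / ((p : ℝ) + 1))
    (c : QIdx → ℝ) (A : Finset QIdx) :
    ‖partialSum w c A‖ ^ 2 ≤ 32 * (∑' p : ℕ, w p ^ 2 / ((p : ℝ) + 1)) * ∑ x ∈ A, |c x| ^ 2 := by
  let degrees := A.image Prod.fst
  let fibre (p : ℕ) : Finset (Option Node) := (A.filter fun x => x.1 = p).image Prod.snd
  have hA (x : QIdx) : x ∈ A ↔ x.1 ∈ degrees ∧ x.2 ∈ fibre x.1 := by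
    simp only [degrees, fibre, Finset.mem_image, Finset.mem_filter]
    constructor
    · exact fun hx => ⟨⟨x, hx, rfl⟩, x, ⟨hx, rfl⟩, rfl⟩
    · rintro ⟨-, y, ⟨hy, hfst⟩, hsnd⟩
      rwa [← Prod.ext hfst hsnd]
  let g (p : ℕ) : Lp ℝ 2 muI := ∑ a ∈ fibre p, (c (p, a) * w p) • quarkletL2 (p, a)
  let D (p : ℕ) : ℝ := ∑ a ∈ fibre p, |c (p, a)| ^ 2
  have hg : partialSum w c A = ∑ p ∈ degrees, g p := Finset.sum_finset_product A degrees fibre hA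
  have hD : ∑ x ∈ A, |c x| ^ 2 = ∑ p ∈ degrees, D p := Finset.sum_finset_product A degrees fibre hA
  have hdegree (p : ℕ) : ‖g p‖ ^ 2 ≤ w p ^ 2 / ((p : ℝ) + 1) * (32 * D p) := by
    refine (norm_sum_quarkletL2_sq_le p _ (fibre p)).trans_eq ?_
    simp only [mul_pow, ← Finset.sum_mul, D, sq_abs]
    ring
  have hD₀ (p : ℕ) : 0 ≤ D p := Finset.sum_nonneg fun a _ => sq_nonneg _
  rw [hg, hD]
  calc ‖∑ p ∈ degrees, g p‖ ^ 2 ≤ (∑ p ∈ degrees, ‖g p‖) ^ 2 := by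
        gcongr
        exact norm_sum_le _ _
    _ ≤ (∑ p ∈ degrees, w p ^ 2 / ((p : ℝ) + 1)) * ∑ p ∈ degrees, 32 * D p :=
        Finset.sum_sq_le_sum_mul_sum_of_sq_le_mul _ (fun p _ => by positivity)
          (fun p _ => mul_nonneg (by norm_num) (hD₀ p)) fun p _ => hdegree p
    _ ≤ (∑' p : ℕ, w p ^ 2 / ((p : ℝ) + 1)) * ∑ p ∈ degrees, 32 * D p := by
        refine mul_le_mul_of_nonneg_right (hw.sum_le_tsum _ fun p _ => by positivity) ?_
        exact Finset.sum_nonneg fun p _ => mul_nonneg (by norm_num) (hD₀ p)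
    _ = 32 * (∑' p : ℕ, w p ^ 2 / ((p : ℝ) + 1)) * ∑ p ∈ degrees, D p := by
        rw [← Finset.mul_sum]
        ring

theorem exists_norm_partialSum_sq_le {w : ℕ → ℝ}
    (hw : Summable fun p : ℕ => w p ^ 2 / ((p : ℝ) + 1)) :
    ∃ C : ℝ, 0 < C ∧ ∀ (c : QIdx → ℝ) (A : Finset QIdx),
      ‖partialSum w c A‖ ^ 2 ≤ C * ∑ x ∈ A, |c x| ^ 2 := by
  refine ⟨32 * (∑' p : ℕ, w p ^ 2 / ((p : ℝ) + 1)) + 1, by positivity, fun c A => ?_⟩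
  refine (norm_partialSum_sq_le hw c A).trans ?_
  gcongr
  exact le_add_of_nonneg_right zero_le_one

theorem norm_sub_partialSum_sq_le {w : ℕ → ℝ} {c : QIdx → ℝ} {C : ℝ} (hC : 0 ≤ C)
    (hstable : ∀ A : Finset QIdx, ‖partialSum w c A‖ ^ 2 ≤ C * ∑ x ∈ A, |c x| ^ 2)
    (hc : Summable fun x => |c x| ^ 2) {f : Lp ℝ 2 muI}
    (hf : HasSum (fun x : QIdx => (c x * w x.1) • quarkletL2 x) f) (A : Finset QIdx) :
    ‖f - partialSum w c A‖ ^ 2 ≤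
      C * ∑' x, (A : Set QIdx)ᶜ.indicator (fun x => |c x| ^ 2) x := by
  refine le_of_tendsto ((hf.sub_const (partialSum w c A)).norm.pow 2) ?_
  filter_upwards [Filter.eventually_ge_atTop A] with B hAB
  have hsdiff : ∑ x ∈ B, (c x * w x.1) • quarkletL2 x - partialSum w c A =
      partialSum w c (B \ A) := by
    rw [sub_eq_iff_eq_add, partialSum, partialSum, Finset.sum_sdiff hAB]
  rw [hsdiff]
  refine (hstable _).trans ?_
  gcongr
  calc ∑ x ∈ B \ A, |c x| ^ 2
      = ∑ x ∈ B \ A, (A : Set QIdx)ᶜ.indicator (fun x => |c x| ^ 2) x :=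
        Finset.sum_congr rfl fun x hx => by
          rw [Set.indicator_of_mem]
          exact (Finset.mem_sdiff.1 hx).2
    _ ≤ ∑' x, (A : Set QIdx)ᶜ.indicator (fun x => |c x| ^ 2) x :=
        (hc.indicator _).sum_le_tsum _ fun x _ =>
          Set.indicator_nonneg (fun _ _ => by positivity) x

theorem summable_sq_div_of_summable_mul_rpow {w : ℕ → ℝ} (hw : ∀ p, 0 ≤ w p)
    (hsum : Summable fun p : ℕ => w p * ((p : ℝ) + 1) ^ (-(1 / 2) : ℝ)) :
    Summable fun p : ℕ => w p ^ 2 / ((p : ℝ) + 1) := by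
  have hnonneg : 0 ≤ fun p : ℕ => w p * ((p : ℝ) + 1) ^ (-(1 / 2) : ℝ) := fun p =>
    mul_nonneg (hw p) (by positivity)
  have hdiag : Function.Injective fun p : ℕ => (p, p) := fun p q h => congrArg Prod.fst h
  refine ((Summable.mul_of_nonneg hsum hsum hnonneg hnonneg).comp_injective hdiag).congr fun p => ?_
  have hrpow : ((p : ℝ) + 1) ^ (-(1 / 2) : ℝ) * ((p : ℝ) + 1) ^ (-(1 / 2) : ℝ) =
      ((p : ℝ) + 1)⁻¹ := by
    rw [← Real.rpow_add (by positivity), ← Real.rpow_neg_one]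
    norm_num
  rw [Function.comp_apply, mul_mul_mul_comm, hrpow, ← sq, div_eq_mul_inv]

end HaarQuarklet

open HaarQuarklet in
theorem lemma4p4_general :
    ∃ K : ℕ → ℝ, ∀ w : ℕ → ℝ, Summable (fun p : ℕ => w p ^ 2 / ((p : ℝ) + 1)) →
      ∃ C : ℝ, 0 < C ∧ ∀ top : Node → Node, IsEnrichment top →
        ∀ c : QIdx → ℝ, Summable (fun x => |c x| ^ 2) →
        ∀ f : MeasureTheory.Lp ℝ 2 muI,
          HasSum (fun x : QIdx => (c x * w x.1) • quarkletL2 x) f →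
        ∀ N : ℕ, 1 ≤ N → ∀ S : ℕ → Finset Node, IsRun (localErr top c) S N →
          ((indices top (trim (localErr top c) (S N)) (refCount (S N))).card : ℝ) ≤
              K ((trim (localErr top c) (S N)).sup Node.level) * N ∧
          ∀ n : ℕ, 1 ≤ n → n ≤ N →
            ‖f - partialSum w c
                (indices top (trim (localErr top c) (S N)) (refCount (S N)))‖ ^ 2 ≤
              C * ((2 * N + 1) / ((N : ℝ) - n + 1)) * bestErr top (localErr top c) n := by
  refine ⟨fun L => ((2 * ((L + 1) * 2 ^ L + 1) : ℕ) : ℝ), fun w hw => ?_⟩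
  obtain ⟨C, hC, hstable⟩ := exists_norm_partialSum_sq_le hw
  refine ⟨C, hC, fun top htop c hc f hf N hN S hS => ⟨?_, fun n hn hnN => ?_⟩⟩
  · dsimp only
    exact_mod_cast hS.card_indices_trim_le hN top
  · have he := isLocalError_localErr htop hc
    have hT := (hS.isTree le_rfl).trim (localErr top c)
    calc _ ≤ C * ∑' x, _ := norm_sub_partialSum_sq_le hC.le (hstable c) hc hf _
      _ ≤ C * globalErr (localErr top c) (trim (localErr top c) (S N)) (refCount (S N)) := by
          gcongr
          exact tsum_compl_indices_le htop hc hT _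
      _ ≤ C * ((2 * N + 1) / ((N : ℝ) - n + 1) * bestErr top (localErr top c) n) := by
          gcongr
          exact he.globalErr_trim_le hS htop hn hnN
      _ = _ := (mul_assoc _ _ _).symm

open HaarQuarklet in
theorem lemma4p4 :
    ∃ K : ℕ → ℝ, ∀ w : ℕ → ℝ, (∀ p, 0 ≤ w p) → w 0 = 1 →
      Summable (fun p : ℕ => w p * ((p : ℝ) + 1) ^ (-(1 / 2) : ℝ)) →
      ∃ C : ℝ, 0 < C ∧ ∀ top : Node → Node, IsEnrichment top →
        ∀ c : QIdx → ℝ, Summable (fun x => |c x| ^ 2) →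
        ∀ f : MeasureTheory.Lp ℝ 2 muI,
          HasSum (fun x : QIdx => (c x * w x.1) • quarkletL2 x) f →
        ∀ N : ℕ, 1 ≤ N → ∀ S : ℕ → Finset Node, IsRun (localErr top c) S N →
          ((indices top (trim (localErr top c) (S N)) (refCount (S N))).card : ℝ) ≤
              K ((trim (localErr top c) (S N)).sup Node.level) * N ∧
          ∀ n : ℕ, 1 ≤ n → n ≤ N →
            ‖f - partialSum w c
                (indices top (trim (localErr top c) (S N)) (refCount (S N)))‖ ^ 2 ≤
              C * ((2 * N + 1) / ((N : ℝ) - n + 1)) * bestErr top (localErr top c) n := by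
  obtain ⟨K, hK⟩ := lemma4p4_general
  exact ⟨K, fun w hw _ hsum => hK w (summable_sq_div_of_summable_mul_rpow hw hsum)⟩
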